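/- Let $G$ be a finite connected graph (multiple edges and self-loops allowed) with edge set $E_G$. Choose an orientation of the edges of $G$ and a $\mathbb Z$-basis of $H_1(G;\mathbb Z)=\ker(\partial:\mathbb Z^{E_G}\to\mathbb Z^{V_G})$, let $\mathcal H_G$ be the matrix of the inclusion $H_1(G;\mathbb Z)\to\mathbb Z^{E_G}$ in this basis, let $D_G$ be the diagonal matrix with entries the edge variables $(x_e)_{e\in E_G}$, and let $\Lambda_G=\mathcal H_G^{T}D_G\mathcal H_G$ be the resulting graph Laplacian matrix. Put $\Psi_G=\det\Lambda_G\in\mathbb Q[x_e,\ e\in E_G]$, $R_G=\mathbb Q[(x_e)_{e\in E_G},\Psi_G^{-1}]$, and let $X_G\subset\mathbb P^{|E_G|-1}$ be the graph hypersurface $\Psi_G=0$ and $\sigma_G=\{(x_e) : x_e>0\}\subset\mathbb P^{|E_G|-1}(\mathbb R)$ the open coordinate simplex. For every integer $k\ge 1$ define the Kähler differential form $$\omega_G^{4k+1}=\mathrm{tr}\left((\Lambda_G^{-1}d\Lambda_G)^{4k+1}\right)\in\Omega^{4k+1}_{R_G/\mathbb Q}.$$ Theorem. The polynomial $\Psi_G$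 does not depend on the choices, $\Lambda_G$ is invertible over $R_G$, and for every $k\ge1$ the form $\omega_G^{4k+1}$ does not depend on the choices. It is a closed form of degree $4k+1$ which is projective: it is the pullback, along the projection from $\mathbb A^{E_G}\setminus\{\Psi_G=0\}$ (minus the origin), of a unique algebraic differential form, again denoted $$\omega_G^{4k+1}\in\Omega^{4k+1}(\mathbb P^{|E_G|-1}\setminus X_G),$$ which is also closed. It has a pole of order at most $k+1$ along $X_G$ and no other singularities: $\Psi_G^{k+1}\,\omega_G^{4k+1}$ is a polynomial form in the $x_e$, and on each standard chart $x_e\neq0$ of $\mathbb P^{|E_G|-1}$ the product of $\omega_G^{4k+1}$ with the $(k+1)$-st power of the local equation $\Psi_G/x_e^{\deg\Psi_G}$ of $X_G$ is regular. In particular $\Psi_G$ has no zero on $\sigma_G$, and $\omega_G^{4k+1}$ is smooth on $\sigma_G$. -/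

import Mathlib

open scoped KaehlerDifferential Graph
open MvPolynomial (homogeneousSubmodule)
attribute [local instance] MvPolynomial.gradedAlgebra

namespace GraphForms

/-- The algebra of Kähler differential forms of the `k`-algebra `A`, the exterior algebra of the
`A`-module `Ω[A⁄k]`; its part of degree `n` is `⋀[A]^n Ω[A⁄k]`. -/
abbrev Forms (k A : Type*) [CommRing k] [CommRing A] [Algebra k A] : Type _ :=
  ExteriorAlgebra A Ω[A⁄k]

noncomputable section DeRham

variable (k A : Type*) [CommRing k] [CommRing A] [Algebra k A]

/-- The one-form `da`. -/
def dFun (a : A) : Forms k A := ExteriorAlgebra.ι A (KaehlerDifferential.D k A a)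

/-- The sign involution, multiplication by `(-1) ^ n` in degree `n`. -/
def signInv : Forms k A →ₐ[A] Forms k A :=
  CliffordAlgebra.involute

theorem signInv_ι (m : Ω[A⁄k]) :
    signInv k A (ExteriorAlgebra.ι A m) = -ExteriorAlgebra.ι A m :=
  CliffordAlgebra.involute_ι m

theorem ι_mul_eq (m : Ω[A⁄k]) (w : Forms k A) :
    ExteriorAlgebra.ι A m * w = signInv k A w * ExteriorAlgebra.ι A m := by
  induction w using ExteriorAlgebra.induction with
  | algebraMap r => simp [Algebra.commutes]
  | ι x =>
    rw [signInv_ι, neg_mul]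
    exact eq_neg_of_add_eq_zero_left (ExteriorAlgebra.ι_add_mul_swap m x)
  | mul a b ha hb => rw [map_mul, ← mul_assoc, ha, mul_assoc, hb, mul_assoc]
  | add a b ha hb => rw [mul_add, map_add, add_mul, ha, hb]

/-- Pairs of forms with the product
`(v, v') * (w, w') = (v * w, v' * w + (sign v) * w')`. The exterior derivative `d` is built
below as the second component of an algebra map `w ↦ (w, d w)`. -/
@[ext]
structure DPair where
  fst : Forms k A
  snd : Forms k A

namespace DPair

instance : Zero (DPair k A) := ⟨⟨0, 0⟩⟩
instance : One (DPair k A) := ⟨⟨1, 0⟩⟩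
instance : Add (DPair k A) := ⟨fun x y => ⟨x.fst + y.fst, x.snd + y.snd⟩⟩
instance : Neg (DPair k A) := ⟨fun x => ⟨-x.fst, -x.snd⟩⟩
instance : Mul (DPair k A) :=
  ⟨fun x y => ⟨x.fst * y.fst, x.snd * y.fst + signInv k A x.fst * y.snd⟩⟩

@[simp] theorem fst_zero : (0 : DPair k A).fst = 0 := rfl
@[simp] theorem snd_zero : (0 : DPair k A).snd = 0 := rfl
@[simp] theorem fst_one : (1 : DPair k A).fst = 1 := rfl
@[simp] theorem snd_one : (1 : DPair k A).snd = 0 := rfl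
variable {k A}
@[simp] theorem fst_add (x y : DPair k A) : (x + y).fst = x.fst + y.fst := rfl
@[simp] theorem snd_add (x y : DPair k A) : (x + y).snd = x.snd + y.snd := rfl
@[simp] theorem fst_neg (x : DPair k A) : (-x).fst = -x.fst := rfl
@[simp] theorem snd_neg (x : DPair k A) : (-x).snd = -x.snd := rfl
@[simp] theorem fst_mul (x y : DPair k A) : (x * y).fst = x.fst * y.fst := rfl
@[simp] theorem snd_mul (x y : DPair k A) :
    (x * y).snd = x.snd * y.fst + signInv k A x.fst * y.snd := rfl
variable (k A)

instance : Ring (DPair k A) where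
  add_assoc x y z := by ext <;> simp [add_assoc]
  zero_add x := by ext <;> simp
  add_zero x := by ext <;> simp
  add_comm x y := by ext <;> simp [add_comm]
  neg_add_cancel x := by ext <;> simp
  nsmul := nsmulRec
  zsmul := zsmulRec
  mul_assoc x y z := by ext <;> simp [mul_assoc, add_mul, mul_add, add_assoc]
  one_mul x := by ext <;> simp
  mul_one x := by ext <;> simp
  zero_mul x := by ext <;> simp
  mul_zero x := by ext <;> simp
  left_distrib x y z := by ext <;> simp [mul_add]; abel
  right_distrib x y z := by ext <;> simp [add_mul]; abel

/-- The map `a ↦ (a, da)`. -/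
def ofRing : A →+* DPair k A where
  toFun a := ⟨algebraMap A _ a, dFun k A a⟩
  map_zero' := by ext <;> simp [dFun]
  map_one' := by ext <;> simp [dFun]
  map_add' a b := by ext <;> simp [dFun]
  map_mul' a b := by
    ext
    · simp
    · simp only [dFun, Derivation.leibniz, map_add, map_smul, snd_mul, AlgHom.commutes]
      rw [← Algebra.commutes, ← Algebra.smul_def, ← Algebra.smul_def, add_comm]

instance : Algebra A (DPair k A) where
  algebraMap := ofRing k A
  smul a x := ofRing k A a * x
  smul_def' _ _ := rfl
  commutes' a x := by
    ext
    · exact Algebra.commutes a x.fst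
    · change dFun k A a * x.fst + signInv k A (algebraMap A _ a) * x.snd =
        x.snd * algebraMap A _ a + signInv k A x.fst * dFun k A a
      rw [AlgHom.commutes, dFun, ι_mul_eq, add_comm, Algebra.commutes]

instance : Algebra k (DPair k A) where
  algebraMap := (ofRing k A).comp (algebraMap k A)
  smul r x := ⟨r • x.fst, r • x.snd⟩
  commutes' r x := Algebra.commutes (algebraMap k A r) x
  smul_def' r x := by
    ext
    · change r • x.fst = algebraMap A (Forms k A) (algebraMap k A r) * x.fst
      rw [← Algebra.smul_def, algebraMap_smul]
    · change r • x.snd = dFun k A (algebraMap k A r) * x.fst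
        + signInv k A (algebraMap A _ (algebraMap k A r)) * x.snd
      rw [AlgHom.commutes, ← Algebra.smul_def, algebraMap_smul]
      simp [dFun]

instance : IsScalarTower k A (DPair k A) := .of_algebraMap_eq fun _ => rfl

@[simp] theorem fst_smul (a : A) (x : DPair k A) : (a • x).fst = a • x.fst :=
  (Algebra.smul_def a x.fst).symm

@[simp] theorem snd_smul (a : A) (x : DPair k A) :
    (a • x).snd = dFun k A a * x.fst + a • x.snd := by
  change dFun k A a * x.fst + signInv k A (algebraMap A _ a) * x.snd = _
  rw [AlgHom.commutes, ← Algebra.smul_def]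

@[simp] theorem fst_smul' (a : k) (x : DPair k A) : (a • x).fst = a • x.fst := rfl
@[simp] theorem snd_smul' (a : k) (x : DPair k A) : (a • x).snd = a • x.snd := rfl

/-- The derivation `a ↦ (da, 0)`. -/
def ofDiff : Derivation k A (DPair k A) where
  toFun a := ⟨dFun k A a, 0⟩
  map_add' a b := by ext <;> simp [dFun]
  map_smul' r a := by
    ext
    · simp only [dFun, RingHom.id_apply, fst_smul', Derivation.map_smul]
      exact LinearMap.map_smul_of_tower _ r _
    · simp
  map_one_eq_zero' := by ext <;> simp [dFun]
  leibniz' a b := by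
    ext
    · simp [dFun]
    · simp only [dFun, snd_smul, snd_add, LinearMap.coe_mk, AddHom.coe_mk, smul_zero, add_zero]
      exact (ExteriorAlgebra.ι_add_mul_swap _ _).symm

/-- The map `m ↦ (m, dm)` on one-forms. -/
def ofOneForm : Ω[A⁄k] →ₗ[A] DPair k A := (ofDiff k A).liftKaehlerDifferential

theorem ofOneForm_D (a : A) :
    ofOneForm k A (KaehlerDifferential.D k A a) = ⟨dFun k A a, 0⟩ :=
  Derivation.liftKaehlerDifferential_comp_D _ a

theorem ofOneForm_spec (m : Ω[A⁄k]) :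
    (ofOneForm k A m).fst = ExteriorAlgebra.ι A m ∧
      ∀ w, Commute (ofOneForm k A m).snd w := by
  have hm : m ∈ Submodule.span A (Set.range (KaehlerDifferential.D k A)) := by
    rw [KaehlerDifferential.span_range_derivation]; trivial
  induction hm using Submodule.span_induction with
  | mem x hx =>
    obtain ⟨a, rfl⟩ := hx
    rw [ofOneForm_D]
    exact ⟨rfl, fun w => Commute.zero_left w⟩
  | zero => simp
  | add x y _ _ hx hy =>
    rw [map_add]
    exact ⟨by simp [hx.1, hy.1], fun w => (hx.2 w).add_left (hy.2 w)⟩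
  | smul a x _ hx =>
    rw [map_smul]
    refine ⟨by simp [hx.1], fun w => ?_⟩
    rw [snd_smul, hx.1]
    refine Commute.add_left ?_ ((hx.2 w).smul_left a)
    change _ * _ = _ * _
    rw [mul_assoc, ι_mul_eq, dFun, ← mul_assoc, ι_mul_eq, mul_assoc]
    congr 1
    exact CliffordAlgebra.involute_involute w

/-- The map `w ↦ (w, dw)`. -/
def lift : Forms k A →ₐ[A] DPair k A :=
  ExteriorAlgebra.lift A ⟨ofOneForm k A, fun m => by
    obtain ⟨h1, h2⟩ := ofOneForm_spec k A m
    ext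
    · simp [h1]
    · simp only [snd_mul, h1, signInv_ι, snd_zero]
      rw [(h2 _).eq, neg_mul, add_neg_cancel]⟩

theorem fst_lift (w : Forms k A) : (lift k A w).fst = w := by
  induction w using ExteriorAlgebra.induction with
  | algebraMap r => rw [AlgHom.commutes]; rfl
  | ι x => rw [lift, ExteriorAlgebra.lift_ι_apply, (ofOneForm_spec k A x).1]
  | mul a b ha hb => rw [map_mul, fst_mul, ha, hb]
  | add a b ha hb => rw [map_add, fst_add, ha, hb]

end DPair

/-- The exterior derivative on Kähler forms: the `k`-linear antiderivation which sends a function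
`a` to `da` and each `da` to zero. -/
def extD : Forms k A →ₗ[k] Forms k A where
  toFun w := (DPair.lift k A w).snd
  map_add' x y := by rw [map_add, DPair.snd_add]
  map_smul' r x := by
    rw [← algebraMap_smul A r x, map_smul, algebraMap_smul]; rfl

theorem extD_algebraMap (a : A) : extD k A (algebraMap A _ a) = dFun k A a := by
  change (DPair.lift k A (algebraMap A _ a)).snd = _
  rw [AlgHom.commutes]; rfl

theorem extD_dFun (a : A) : extD k A (dFun k A a) = 0 := by
  change (DPair.lift k A (dFun k A a)).snd = _
  rw [dFun, DPair.lift, ExteriorAlgebra.lift_ι_apply, DPair.ofOneForm_D]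

theorem extD_mul (v w : Forms k A) :
    extD k A (v * w) = extD k A v * w + signInv k A v * extD k A w := by
  change (DPair.lift k A (v * w)).snd = _
  rw [map_mul, DPair.snd_mul, DPair.fst_lift, DPair.fst_lift]; rfl

end DeRham

noncomputable section Pullback

variable {k A B : Type*} [CommRing k] [CommRing A] [CommRing B] [Algebra k A] [Algebra k B]

/-- The pullback of forms along a map of algebras; it sends `a₀ da₁ ⋯ daₙ` to
`φ a₀ d(φ a₁) ⋯ d(φ aₙ)`. -/
def formPullback (φ : A →ₐ[k] B) : Forms k A →ₐ[k] Forms k B :=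
  letI := φ.toRingHom.toAlgebra
  haveI : IsScalarTower k A B := .of_algebraMap_eq fun r => (φ.commutes r).symm
  (ExteriorAlgebra.lift A
    ⟨((ExteriorAlgebra.ι B).restrictScalars A).comp (KaehlerDifferential.map k k A B),
      fun _ => ExteriorAlgebra.ι_sq_zero _⟩).restrictScalars k

theorem formPullback_algebraMap (φ : A →ₐ[k] B) (a : A) :
    formPullback φ (algebraMap A _ a) = algebraMap B _ (φ a) := by
  let _ := φ.toRingHom.toAlgebra
  have _ : IsScalarTower k A B := .of_algebraMap_eq fun r => (φ.commutes r).symm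
  simp only [formPullback, AlgHom.restrictScalars_apply, AlgHom.commutes]
  rfl

theorem formPullback_dFun (φ : A →ₐ[k] B) (a : A) :
    formPullback φ (dFun k A a) = dFun k B (φ a) := by
  let _ := φ.toRingHom.toAlgebra
  have _ : IsScalarTower k A B := .of_algebraMap_eq fun r => (φ.commutes r).symm
  simp only [formPullback, dFun, AlgHom.restrictScalars_apply]
  refine (ExteriorAlgebra.lift_ι_apply A _ _ _).trans ?_
  exact congrArg (ExteriorAlgebra.ι B) (KaehlerDifferential.map_D k k A B a)

end Pullback

noncomputable section Trace

variable {k A : Type*} [CommRing k] [CommRing A] [Algebra k A]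
variable {n : Type*} [Fintype n] [DecidableEq n]

/-- The matrix of one-forms `X⁻¹ dX` (for invertible `X`). -/
def maurerCartan (k : Type*) [CommRing k] [Algebra k A] (X : Matrix n n A) :
    Matrix n n (Forms k A) :=
  X⁻¹.map (algebraMap A (Forms k A)) * X.map (dFun k A)

/-- The invariant trace `tr ((X⁻¹ dX) ^ m)`. -/
def invariantTrace (k : Type*) [CommRing k] [Algebra k A] (X : Matrix n n A) (m : ℕ) :
    Forms k A :=
  (maurerCartan k X ^ m).trace

end Trace

noncomputable section Homogeneous

variable {σ : Type*}

instance (M : Submonoid (MvPolynomial σ ℚ)) :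
    Algebra ℚ (HomogeneousLocalization (homogeneousSubmodule σ ℚ) M) where
  algebraMap := (algebraMap (homogeneousSubmodule σ ℚ 0) _).comp
    (algebraMap ℚ (homogeneousSubmodule σ ℚ 0))
  commutes' _ _ := mul_comm _ _
  smul_def' r x := by
    apply HomogeneousLocalization.val_injective
    rw [HomogeneousLocalization.val_smul, HomogeneousLocalization.val_mul, Algebra.smul_def]
    congr 1

end Homogeneous

noncomputable section Graphs

variable {α β : Type*} (G : Graph α β)

/-- A multigraph is connected if it has a vertex and any two vertices are joined by a path. -/
def GraphConnected : Prop :=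
  V(G).Nonempty ∧ ∀ x ∈ V(G), ∀ y ∈ V(G), Relation.ReflTransGen G.Adj x y

/-- An orientation of every edge (self-loops are oriented in the only possible way). -/
structure EdgeOrientation where
  src : E(G) → V(G)
  tgt : E(G) → V(G)
  isLink : ∀ e : E(G), G.IsLink e (src e) (tgt e)

variable {G}

/-- The boundary map `∂ e = src e - tgt e` from `ℤ^E` to `ℤ^V`. -/
def EdgeOrientation.boundary (o : EdgeOrientation G) : (E(G) →₀ ℤ) →ₗ[ℤ] (V(G) →₀ ℤ) :=
  Finsupp.linearCombination ℤ
    fun e => Finsupp.single (o.src e) 1 - Finsupp.single (o.tgt e) 1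

/-- `H₁(G; ℤ)`, the kernel of the boundary map. -/
abbrev EdgeOrientation.H1 (o : EdgeOrientation G) : Submodule ℤ (E(G) →₀ ℤ) :=
  LinearMap.ker o.boundary

variable (G)

/-- The choices which enter a Laplacian matrix of `G`: an orientation of the edges and a
`ℤ`-basis of `H₁(G; ℤ)`. -/
structure LaplacianChoice where
  orientation : EdgeOrientation G
  basis : Module.Basis (Fin (Module.finrank ℤ orientation.H1)) ℤ orientation.H1

instance : Nonempty (EdgeOrientation G) := by
  have h (e : E(G)) : ∃ p : V(G) × V(G), G.IsLink e p.1 p.2 := by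
    obtain ⟨x, y, hxy⟩ := (G.edge_mem_iff_exists_isLink e).1 e.2
    exact ⟨(⟨x, hxy.left_mem⟩, ⟨y, hxy.right_mem⟩), hxy⟩
  choose p hp using h
  exact ⟨⟨fun e => (p e).1, fun e => (p e).2, hp⟩⟩

instance [Finite E(G)] : Nonempty (LaplacianChoice G) :=
  (inferInstance : Nonempty (EdgeOrientation G)).map
    fun o => ⟨o, Module.finBasis ℤ o.H1⟩

variable {G}

theorem X_mem (e : E(G)) : MvPolynomial.X e ∈ homogeneousSubmodule E(G) ℚ 1 :=
  MvPolynomial.isHomogeneous_X ℚ e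

variable [Fintype E(G)]

/-- The number of rows of the Laplacian matrix: the loop number of `G`. -/
abbrev LaplacianChoice.rank (c : LaplacianChoice G) : ℕ :=
  Module.finrank ℤ c.orientation.H1

/-- The edge-cycle incidence matrix: the matrix of the inclusion of `H₁(G; ℤ)` in `ℤ^E`. -/
def LaplacianChoice.incidence (c : LaplacianChoice G) : Matrix E(G) (Fin c.rank) ℤ :=
  Matrix.of fun e i => (c.basis i : E(G) →₀ ℤ) e

open Classical in
/-- The Laplacian matrix `Hᵀ D H`, with `D` the diagonal matrix of the edge variables. -/
def LaplacianChoice.laplacian (c : LaplacianChoice G) :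
    Matrix (Fin c.rank) (Fin c.rank) (MvPolynomial E(G) ℚ) :=
  let H : Matrix E(G) (Fin c.rank) (MvPolynomial E(G) ℚ) :=
    Matrix.map c.incidence fun m => (m : MvPolynomial E(G) ℚ)
  let D : Matrix E(G) E(G) (MvPolynomial E(G) ℚ) := Matrix.diagonal MvPolynomial.X
  let HD : Matrix (Fin c.rank) E(G) (MvPolynomial E(G) ℚ) := H.transpose * D
  HD * H

theorem LaplacianChoice.laplacian_apply (c : LaplacianChoice G) (i j : Fin c.rank) :
    c.laplacian i j = ∑ e : E(G), (c.incidence e i : MvPolynomial E(G) ℚ) *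
      MvPolynomial.X e * (c.incidence e j : MvPolynomial E(G) ℚ) := by
  classical
  rw [laplacian, Matrix.mul_apply]
  refine Finset.sum_congr rfl fun e _ => ?_
  rw [Matrix.mul_diagonal]
  rfl

variable (G)

/-- The loop number of `G`. -/
def loopNumber : ℕ := (Classical.arbitrary (LaplacianChoice G)).rank

/-- The graph polynomial `Ψ_G`, the determinant of a Laplacian matrix of `G`. -/
def graphPoly : MvPolynomial E(G) ℚ :=
  (Classical.arbitrary (LaplacianChoice G)).laplacian.det

theorem graphPoly_mem : graphPoly G ∈ homogeneousSubmodule E(G) ℚ (loopNumber G) := by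
  classical
  rw [MvPolynomial.mem_homogeneousSubmodule, graphPoly, loopNumber, Matrix.det_apply]
  set c := Classical.arbitrary (LaplacianChoice G)
  have hint (m : ℤ) : (m : MvPolynomial E(G) ℚ).IsHomogeneous 0 := by
    simpa using MvPolynomial.isHomogeneous_C E(G) (m : ℚ)
  have hentry (i j) : (c.laplacian i j).IsHomogeneous 1 := by
    rw [LaplacianChoice.laplacian_apply]
    refine MvPolynomial.IsHomogeneous.sum _ _ _ fun e _ => ?_
    exact ((hint _).mul (MvPolynomial.isHomogeneous_X ℚ e)).mul (hint _)
  refine MvPolynomial.IsHomogeneous.sum _ _ _ fun s _ => ?_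
  have hp : (∏ i, c.laplacian (s i) i).IsHomogeneous c.rank := by
    simpa using MvPolynomial.IsHomogeneous.prod Finset.univ (fun i => c.laplacian (s i) i)
      (fun _ => 1) fun i _ => hentry _ _
  rw [Units.smul_def, zsmul_eq_mul]
  simpa using (hint _).mul hp

/-! ### Rings of functions -/

/-- `ℚ[x_e, Ψ_G⁻¹]`: functions on the complement of `Ψ_G = 0` in affine space. -/
abbrev ConeRing : Type _ := Localization.Away (graphPoly G)

variable {G}

/-- Functions on the standard affine chart `x_e ≠ 0` of projective space. -/
abbrev StdChartRing (e : E(G)) : Type _ :=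
  HomogeneousLocalization.Away (homogeneousSubmodule E(G) ℚ) (MvPolynomial.X e)

/-- Functions on the chart `x_e ≠ 0` of the complement of the graph hypersurface in
projective space. -/
abbrev ChartRing (e : E(G)) : Type _ :=
  HomogeneousLocalization.Away (homogeneousSubmodule E(G) ℚ)
    (graphPoly G * MvPolynomial.X e)

/-- Functions on the overlap of the charts `x_e ≠ 0` and `x_f ≠ 0` of the complement of the
graph hypersurface in projective space. -/
abbrev OverlapRing (e f : E(G)) : Type _ :=
  HomogeneousLocalization.Away (homogeneousSubmodule E(G) ℚ)
    (graphPoly G * MvPolynomial.X e * MvPolynomial.X f)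

/-- Functions on the preimage of the chart `x_e ≠ 0` in the complement of `Ψ_G = 0` in
affine space. -/
abbrev ConeChartRing (e : E(G)) : Type _ :=
  Localization.Away (graphPoly G * MvPolynomial.X e)

/-- Restriction of functions from the chart `e` to its overlap with the chart `f`. -/
def chartToOverlapLeft (e f : E(G)) : ChartRing e →ₐ[ℚ] OverlapRing e f :=
  (HomogeneousLocalization.awayMap (homogeneousSubmodule E(G) ℚ) (X_mem f)
    (rfl : graphPoly G * MvPolynomial.X e * MvPolynomial.X f = _)).toRatAlgHom

/-- Restriction of functions from the chart `f` to its overlap with the chart `e`. -/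
def chartToOverlapRight (e f : E(G)) : ChartRing f →ₐ[ℚ] OverlapRing e f :=
  (HomogeneousLocalization.awayMap (homogeneousSubmodule E(G) ℚ) (X_mem e)
    (mul_right_comm (graphPoly G) (MvPolynomial.X e) (MvPolynomial.X f))).toRatAlgHom

/-- Restriction of functions from a standard chart to the complement of the hypersurface. -/
def stdChartToChart (e : E(G)) : StdChartRing e →ₐ[ℚ] ChartRing e :=
  (HomogeneousLocalization.awayMap (homogeneousSubmodule E(G) ℚ) (graphPoly_mem G)
    (mul_comm (graphPoly G) (MvPolynomial.X e))).toRatAlgHom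

/-- Pullback of functions along the projection from the cone, over the chart `e`. -/
def chartToConeChart (e : E(G)) : ChartRing e →ₐ[ℚ] ConeChartRing e :=
  (algebraMap (ChartRing e) (ConeChartRing e)).toRatAlgHom

/-- Restriction of functions from the cone to the part of it over the chart `e`. -/
def coneToConeChart (e : E(G)) : ConeRing G →ₐ[ℚ] ConeChartRing e :=
  (IsLocalization.Away.awayToAwayRight (S := ConeRing G) (P := ConeChartRing e)
    (graphPoly G) (MvPolynomial.X e)).toRatAlgHom

variable (G) in
/-- Restriction of functions from affine space to the complement of `Ψ_G = 0`. -/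
def polyToCone : MvPolynomial E(G) ℚ →ₐ[ℚ] ConeRing G :=
  (algebraMap (MvPolynomial E(G) ℚ) (ConeRing G)).toRatAlgHom

/-- The affine coordinate `x_f / x_e` on the chart `x_e ≠ 0`. -/
def coord (e f : E(G)) : StdChartRing e :=
  HomogeneousLocalization.Away.mk _ (X_mem e) 1 (MvPolynomial.X f) (X_mem f)

/-- The equation `Ψ_G / x_e ^ h` of the graph hypersurface in the chart `x_e ≠ 0`. -/
def localEquation (e : E(G)) : StdChartRing e :=
  HomogeneousLocalization.Away.mk _ (X_mem e) (loopNumber G) (graphPoly G)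
    (by simpa using graphPoly_mem G)

/-- The value at a real point with homogeneous coordinates `x` of a function on the chart `e`
of the complement of the graph hypersurface (zero if the point is not in this chart). -/
def realValue {e : E(G)} (c : ChartRing e) (x : E(G) → ℝ) : ℝ :=
  open Classical in
  if h : IsUnit ((MvPolynomial.aeval x : MvPolynomial E(G) ℚ →ₐ[ℚ] ℝ).toRingHom
      (graphPoly G * MvPolynomial.X e)) then
    IsLocalization.Away.lift (S := ConeChartRing e) _ h (chartToConeChart e c)
  else 0

variable (G) in
/-- The cone of positive real vectors; the open simplex `σ_G` is its image in projective
space. -/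
def simplexCone : Set (E(G) → ℝ) := {x | ∀ e, 0 < x e}

/-! ### Forms -/

/-- The form `tr ((Λ⁻¹ dΛ) ^ m)` on the complement of `Ψ_G = 0` in affine space. -/
def LaplacianChoice.canonicalForm (c : LaplacianChoice G) (m : ℕ) : Forms ℚ (ConeRing G) :=
  invariantTrace ℚ (c.laplacian.map (polyToCone G)) m

variable (G) in
/-- An algebraic `n`-form on the complement of the graph hypersurface in projective space:
a Kähler `n`-form on every affine chart, with agreement on the overlaps. -/
@[ext]
structure ProjectiveForm (n : ℕ) where
  form : ∀ e : E(G), Forms ℚ (ChartRing e)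
  mem : ∀ e, form e ∈ ⋀[ChartRing e]^n Ω[ChartRing e⁄ℚ]
  compat : ∀ e f, formPullback (chartToOverlapLeft e f) (form e) =
    formPullback (chartToOverlapRight e f) (form f)

namespace ProjectiveForm

variable {n : ℕ} (η : ProjectiveForm G n)

/-- `ω` is the pullback of `η` along the projection from the cone. -/
def PullsBackTo (ω : Forms ℚ (ConeRing G)) : Prop :=
  ∀ e, formPullback (chartToConeChart e) (η.form e) = formPullback (coneToConeChart e) ω

def IsClosed : Prop := ∀ e, extD ℚ (ChartRing e) (η.form e) = 0

/-- `η` has a pole of order at most `r` along the graph hypersurface and no other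
singularities on projective space. -/
def PoleOrderLE (r : ℕ) : Prop :=
  ∀ e, ∃ N ∈ ⋀[StdChartRing e]^n Ω[StdChartRing e⁄ℚ],
    stdChartToChart e (localEquation e) ^ r • η.form e = formPullback (stdChartToChart e) N

/-- `η` is a smooth form on the open simplex: in the coordinates `x_f / x_e` of every chart
(each of which contains the simplex) its coefficients are defined and infinitely
differentiable at all positive real points. -/
def SmoothOnSimplex : Prop :=
  (∀ x ∈ simplexCone G, MvPolynomial.aeval x (graphPoly G) ≠ (0 : ℝ)) ∧
  ∀ e, ∃ c : (Fin n → E(G)) → ChartRing e,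
    η.form e = ∑ I, c I • ExteriorAlgebra.ιMulti (ChartRing e) n
      (fun j => KaehlerDifferential.D ℚ (ChartRing e) (stdChartToChart e (coord e (I j)))) ∧
    ∀ I, ContDiffOn ℝ (⊤ : ℕ∞) (realValue (c I)) (simplexCone G)

end ProjectiveForm

end Graphs

end GraphForms

open GraphForms

/-!
The heart of the matter is the bound for the order of the pole. For a symmetric matrix `X` over a
ring of functions put `p = det X` and `A = adj X`. Since `X⁻¹ = A / p`, the pole of
`tr ((X⁻¹ dX) ^ (4 k + 1))` has order at most `k + 1` if `tr ((A dX) ^ (4 k + 1))` is divisible by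
`p ^ (3 k)`. The adjugate has rank one modulo the determinant: for a constant vector `u`, the
coefficient of `s` in `adj X (X + s u uᵀ) adj (X + s u uᵀ)` gives `g A = p R + a aᵀ`, with `R`
symmetric, `a = A u` and `g` the derivative of `det (X + s u uᵀ)` at `s = 0`
(`exists_detDeriv_smul_adjugate_eq`). So `g ^ (4 k + 1)` times the trace is a combination of traces
of words in `p R dX` and `a aᵀ dX`, which are products of the forms
`α_d = aᵀ dX (R dX) ^ (d - 1) a` of degree `d`, each with a factor `p ^ (d - 1)`. As `dX` and `R`
are symmetric and one-forms anticommute, `α₁² = α₂ = α₃ = 0`. Hence all but one of the factors of a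
nonzero product have degree at least four, there are at most `k + 1` of them, and `p` occurs at
least `3 k` times (`exists_trace_pow_eq_pow_smul`, `exists_trace_eq_pow_smul_of_rank_one`). The
factor `g` is removed in a universal situation: for the generic symmetric matrix plus a scalar
variable `y`, the determinant is monic in `y`, its resultant with `g` is nonzero, as one sees for
diagonal matrices with distinct entries, and so `g` is a nonzerodivisor modulo `p`. The general
case follows by specialisation (`exists_trace_generic_eq`, `exists_trace_adjugate_eq`).

The rest is the calculus of the matrix `μ = X⁻¹ dX`. Traces of even powers of `μ` vanish by
cyclicity, so the Maurer–Cartan equation `dμ = -μ²` shows that the odd traces are closed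
(`extD_invariantTrace`). They do not change under congruence by constant matrices
(`invariantTrace_conj`), and two choices of an orientation and a basis give Laplacian matrices
congruent over `ℤ` (`LaplacianChoice.exists_laplacian_eq`). They also do not change when `X` is
multiplied by an invertible function (`invariantTrace_smul`); therefore the traces of the matrices
`Λ / x_e` on the charts agree on overlaps and have the form of `Λ` as pullback to the cone
(`LaplacianChoice.projectiveForm`). The pullback from a chart to the cone over it is injective,
because the projection has the section `x_e = 1`, so this projective form is unique. Finally,
`Λ` is positive definite at positive real points, so `Ψ_G` does not vanish there; the functions on
a chart are quotients of polynomials by powers of `Ψ_G x_e`, and the coordinate differentials span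
the one-forms, which gives smoothness.
-/

namespace GraphForms

/-! ### Signs in exterior algebras -/

section ExteriorSigns

variable {S M : Type*} [CommRing S] [AddCommGroup M] [Module S M]

theorem ι_mul_of_mem_exteriorPower {b : ℕ} (m : M) {y : ExteriorAlgebra S M}
    (hy : y ∈ ⋀[S]^b M) :
    ExteriorAlgebra.ι S m * y = (-1) ^ b * (y * ExteriorAlgebra.ι S m) := by
  induction hy using Submodule.pow_induction_on_left' with
  | algebraMap r => simp [Algebra.commutes]
  | add x y i _ _ hx hy => rw [mul_add, hx, hy, add_mul, mul_add]
  | mem_mul z hz i x _ hx =>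
    obtain ⟨z, rfl⟩ := hz
    have h : ExteriorAlgebra.ι S m * ExteriorAlgebra.ι S z
        = -(ExteriorAlgebra.ι S z * ExteriorAlgebra.ι S m) :=
      eq_neg_of_add_eq_zero_left (ExteriorAlgebra.ι_add_mul_swap m z)
    rw [← mul_assoc, h, neg_mul, mul_assoc, hx, pow_succ', ← mul_assoc,
      ((Commute.one_right (ExteriorAlgebra.ι S z)).neg_right.pow_right i).eq]
    simp only [mul_assoc, neg_mul, one_mul]

theorem mul_comm_of_mem_exteriorPower {a b : ℕ} {x y : ExteriorAlgebra S M}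
    (hx : x ∈ ⋀[S]^a M) (hy : y ∈ ⋀[S]^b M) : x * y = (-1) ^ (a * b) * (y * x) := by
  induction hx using Submodule.pow_induction_on_left' with
  | algebraMap r => simp [Algebra.commutes]
  | add x z i _ _ hx hz => rw [mul_add, add_mul, hx, hz, mul_add]
  | mem_mul z hz i x _ hx =>
    obtain ⟨z, rfl⟩ := hz
    have hc : Commute (ExteriorAlgebra.ι S z) ((-1) ^ (i * b)) :=
      (Commute.one_right (ExteriorAlgebra.ι S z)).neg_right.pow_right _
    rw [mul_assoc, hx, ← mul_assoc, hc.eq, mul_assoc, ← mul_assoc _ y x,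
      ι_mul_of_mem_exteriorPower z hy, Nat.succ_mul, pow_add]
    simp only [mul_assoc]

variable {l m n : Type*} [Fintype m]

theorem mul_mem_exteriorPower {a b : ℕ} {x y : ExteriorAlgebra S M}
    (hx : x ∈ ⋀[S]^a M) (hy : y ∈ ⋀[S]^b M) : x * y ∈ ⋀[S]^(a + b) M := by
  rw [ExteriorAlgebra.exteriorPower, pow_add]
  exact Submodule.mul_mem_mul hx hy

theorem algebraMap_mem_exteriorPower (r : S) :
    algebraMap S (ExteriorAlgebra S M) r ∈ ⋀[S]^0 M := by
  rw [ExteriorAlgebra.exteriorPower, pow_zero]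
  exact Submodule.algebraMap_mem r

theorem ι_mem_exteriorPower (x : M) : ExteriorAlgebra.ι S x ∈ ⋀[S]^1 M := by
  rw [ExteriorAlgebra.exteriorPower, pow_one]
  exact LinearMap.mem_range_self _ x

theorem matrix_mul_mem_exteriorPower {a b : ℕ} {A : Matrix l m (ExteriorAlgebra S M)}
    {B : Matrix m n (ExteriorAlgebra S M)} (hA : ∀ i j, A i j ∈ ⋀[S]^a M)
    (hB : ∀ i j, B i j ∈ ⋀[S]^b M) (i : l) (j : n) : (A * B) i j ∈ ⋀[S]^(a + b) M := by
  rw [Matrix.mul_apply]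
  exact Submodule.sum_mem _ fun k _ => mul_mem_exteriorPower (hA i k) (hB k j)

theorem matrix_pow_mem_exteriorPower [DecidableEq m] {a : ℕ}
    {A : Matrix m m (ExteriorAlgebra S M)} (hA : ∀ i j, A i j ∈ ⋀[S]^a M) (r : ℕ) (i j : m) :
    (A ^ r) i j ∈ ⋀[S]^(r * a) M := by
  induction r generalizing i j with
  | zero =>
    rw [pow_zero, Nat.zero_mul, Matrix.one_apply]
    split_ifs
    · rw [← map_one (algebraMap S _)]; exact algebraMap_mem_exteriorPower 1
    · exact zero_mem _
  | succ r ih =>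
    rw [pow_succ, Nat.succ_mul]
    exact matrix_mul_mem_exteriorPower ih hA i j

/-- Cyclicity of the trace, with the sign of graded commutativity. -/
theorem trace_mul_comm_of_mem_exteriorPower [Fintype n] {a b : ℕ}
    {A : Matrix m n (ExteriorAlgebra S M)}
    {B : Matrix n m (ExteriorAlgebra S M)} (hA : ∀ i j, A i j ∈ ⋀[S]^a M)
    (hB : ∀ i j, B i j ∈ ⋀[S]^b M) :
    (A * B).trace = (-1) ^ (a * b) * (B * A).trace := by
  simp only [Matrix.trace, Matrix.diag_apply, Matrix.mul_apply, Finset.mul_sum]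
  rw [Finset.sum_comm]
  exact Finset.sum_congr rfl fun j _ => Finset.sum_congr rfl fun i _ =>
    mul_comm_of_mem_exteriorPower (hA i j) (hB j i)

end ExteriorSigns

/-! ### Poles of the invariant trace when the adjugate has rank one modulo the determinant -/

section RankOne

variable {S M : Type*} [CommRing S] [AddCommGroup M] [Module S M]

/-- Elements of the form `p ^ (d - ⌊d / 4⌋) • u + τ * p ^ ((d - 1) - ⌊(d - 1) / 4⌋) • v`. A product
of forms of degrees `d₁, …, d_r` and total degree `d`, each scaled by `p ^ (dᵢ - 1)`, is of this
form if all `dᵢ ≥ 4` except for at most one factor `τ` of degree one. -/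
def PoleFiltration (p : S) (τ : ExteriorAlgebra S M) (d : ℕ) (x : ExteriorAlgebra S M) : Prop :=
  ∃ u v, x = p ^ (d - d / 4) • u + τ * p ^ ((d - 1) - (d - 1) / 4) • v

namespace PoleFiltration

variable {p : S} {τ : ExteriorAlgebra S M}

theorem of_pow_smul {d e : ℕ} (h : d - d / 4 ≤ e) (x : ExteriorAlgebra S M) :
    PoleFiltration p τ d (p ^ e • x) := by
  refine ⟨p ^ (e - (d - d / 4)) • x, 0, ?_⟩
  rw [smul_smul, ← pow_add, Nat.add_sub_cancel' h, smul_zero, mul_zero, add_zero]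

theorem zero (d : ℕ) : PoleFiltration p τ d 0 := ⟨0, 0, by simp⟩

theorem self : PoleFiltration p τ 1 τ := ⟨0, 1, by simp⟩

theorem add {d : ℕ} {x y : ExteriorAlgebra S M} (hx : PoleFiltration p τ d x)
    (hy : PoleFiltration p τ d y) : PoleFiltration p τ d (x + y) := by
  obtain ⟨u, v, rfl⟩ := hx
  obtain ⟨u', v', rfl⟩ := hy
  exact ⟨u + u', v + v', by simp only [smul_add, mul_add]; abel⟩

theorem of_mul_pow_smul {d e : ℕ} (h : (d - 1) - (d - 1) / 4 ≤ e) (x : ExteriorAlgebra S M) :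
    PoleFiltration p τ d (τ * p ^ e • x) := by
  refine ⟨0, p ^ (e - ((d - 1) - (d - 1) / 4)) • x, ?_⟩
  rw [smul_smul, ← pow_add, Nat.add_sub_cancel' h, smul_zero, zero_add]

theorem mul {a b : ℕ} (ha : 1 ≤ a) (hb : 1 ≤ b) (hτ : τ * τ = 0) (hc : ∀ x, ∃ y, x * τ = τ * y)
    {x y : ExteriorAlgebra S M}
    (hx : PoleFiltration p τ a x) (hy : PoleFiltration p τ b y) :
    PoleFiltration p τ (a + b) (x * y) := by
  obtain ⟨u, v, rfl⟩ := hx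
  obtain ⟨u', v', rfl⟩ := hy
  obtain ⟨w, hw⟩ := hc u
  obtain ⟨w', hw'⟩ := hc v
  have key (r s : ℕ) (x y : ExteriorAlgebra S M) :
      p ^ r • x * p ^ s • y = p ^ (r + s) • (x * y) := by
    rw [smul_mul_smul_comm, ← pow_add]
  have e2 (r s : ℕ) : p ^ r • u * (τ * p ^ s • v') = τ * p ^ (r + s) • (w * v') := by
    rw [← mul_assoc, smul_mul_assoc, hw, ← mul_smul_comm, mul_assoc, key]
  have e3 (r s : ℕ) : τ * p ^ r • v * p ^ s • u' = τ * p ^ (r + s) • (v * u') := by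
    rw [mul_assoc, key]
  have e4 (r s : ℕ) : τ * p ^ r • v * (τ * p ^ s • v') = 0 := by
    rw [mul_assoc, ← mul_assoc (_ • v), smul_mul_assoc, hw', ← mul_smul_comm, mul_assoc τ,
      ← mul_assoc τ τ, hτ, zero_mul]
  rw [add_mul, mul_add, mul_add, e4, add_zero, e2, e3, key]
  exact ((of_pow_smul (by lia) _).add (of_mul_pow_smul (by lia) _)).add
    (of_mul_pow_smul (by lia) _)

theorem exists_eq_pow_smul {k : ℕ} {x : ExteriorAlgebra S M}
    (hx : PoleFiltration p τ (4 * k + 1) x) : ∃ y, x = p ^ (3 * k) • y := by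
  obtain ⟨u, v, rfl⟩ := hx
  have e1 : (4 * k + 1) - (4 * k + 1) / 4 = 3 * k + 1 := by lia
  have e2 : (4 * k + 1 - 1) - (4 * k + 1 - 1) / 4 = 3 * k := by lia
  exact ⟨p • u + τ * v, by rw [e1, e2, smul_add, smul_smul, ← pow_succ, mul_smul_comm]⟩

end PoleFiltration

variable {n : Type*} [Fintype n]

/-- A quadratic form in anticommuting one-forms, with symmetric coefficients, vanishes. -/
theorem sum_ι_mul_algebraMap_mul_ι_eq_zero (h2 : IsUnit (2 : S)) (Q : Matrix n n S)
    (hQ : Q.IsSymm) (b : n → M) :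
    ∑ i, ∑ j, ExteriorAlgebra.ι S (b i) * algebraMap S _ (Q i j) * ExteriorAlgebra.ι S (b j)
      = 0 := by
  have h : ∀ x : ExteriorAlgebra S M, x = -x → x = 0 := fun x hx => by
    have : (2 : S) • x = 0 := by rw [two_smul]; nth_rw 1 [hx]; exact neg_add_cancel x
    simpa using (h2.smul_eq_zero).1 this
  apply h
  conv_lhs => rw [Finset.sum_comm]
  rw [← Finset.sum_neg_distrib]
  refine Finset.sum_congr rfl fun i _ => ?_
  rw [← Finset.sum_neg_distrib]
  refine Finset.sum_congr rfl fun j _ => ?_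
  rw [hQ.apply i j, ← Algebra.commutes, ← Algebra.commutes, mul_assoc, mul_assoc,
    eq_neg_of_add_eq_zero_left (ExteriorAlgebra.ι_add_mul_swap (b j) (b i)), mul_neg]

/-- A cubic form in anticommuting one-forms, symmetric in the outer ones, vanishes. -/
theorem sum_ι_mul_ι_mul_ι_eq_zero (h2 : IsUnit (2 : S)) (Q : Matrix n n M)
    (hQ : Q.IsSymm) (b : n → M) :
    ∑ i, ∑ j, ExteriorAlgebra.ι S (b i) * ExteriorAlgebra.ι S (Q i j) * ExteriorAlgebra.ι S (b j)
      = 0 := by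
  have h : ∀ x : ExteriorAlgebra S M, x = -x → x = 0 := fun x hx => by
    have : (2 : S) • x = 0 := by rw [two_smul]; nth_rw 1 [hx]; exact neg_add_cancel x
    simpa using (h2.smul_eq_zero).1 this
  have sw (x y : M) : ExteriorAlgebra.ι S x * ExteriorAlgebra.ι S y
      = -(ExteriorAlgebra.ι S y * ExteriorAlgebra.ι S x) :=
    eq_neg_of_add_eq_zero_left (ExteriorAlgebra.ι_add_mul_swap x y)
  apply h
  conv_lhs => rw [Finset.sum_comm]
  rw [← Finset.sum_neg_distrib]
  refine Finset.sum_congr rfl fun i _ => ?_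
  rw [← Finset.sum_neg_distrib]
  refine Finset.sum_congr rfl fun j _ => ?_
  rw [hQ.apply i j, sw (b j), neg_mul, mul_assoc, sw (b j), mul_neg, neg_neg, ← mul_assoc,
    sw (Q i j), neg_mul]

/-- Divisibility of the trace of a power of `p ρ + c β`, where `ρ` and `β` consist of one-forms and
`c` of functions, when the forms `β ρ c` and `β ρ² c` vanish. Cutting the words of length `4 k + 1`
in `p ρ` and `c β` at the letters `c β` writes their traces as products of the forms
`p ^ (d - 1) β ρ ^ (d - 1) c` of degree `d`. Those with `d = 2, 3` vanish and the one with `d = 1`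
squares to zero, so few factors occur, and the power of `p` is high. -/
theorem exists_trace_pow_eq_pow_smul [DecidableEq n] (p : S)
    {ρ : Matrix n n (ExteriorAlgebra S M)} {c : Matrix n Unit (ExteriorAlgebra S M)}
    {β : Matrix Unit n (ExteriorAlgebra S M)} (dρ : ∀ i j, ρ i j ∈ ⋀[S]^1 M)
    (dc : ∀ i j, c i j ∈ ⋀[S]^0 M) (dβ : ∀ i j, β i j ∈ ⋀[S]^1 M)
    (hα2 : (β * ρ * c : Matrix Unit Unit _) () () = 0)
    (hα3 : (β * ρ ^ 2 * c : Matrix Unit Unit _) () () = 0) (k : ℕ) :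
    ∃ N, ((p • ρ + c * β) ^ (4 * k + 1)).trace = p ^ (3 * k) • N := by
  set W : Matrix n n (ExteriorAlgebra S M) := p • ρ + c * β with hW
  have dW (i j) : W i j ∈ ⋀[S]^1 M := by
    refine add_mem (Submodule.smul_mem _ _ (dρ i j)) ?_
    exact matrix_mul_mem_exteriorPower (a := 0) (b := 1) dc dβ i j
  set τ : ExteriorAlgebra S M := (β * c) () () with hτ
  obtain ⟨t, ht⟩ : ∃ t, ExteriorAlgebra.ι S t = τ := by
    have : τ ∈ ⋀[S]^1 M := matrix_mul_mem_exteriorPower (a := 1) (b := 0) dβ dc _ _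
    rwa [ExteriorAlgebra.exteriorPower, pow_one] at this
  have hττ : τ * τ = 0 := by rw [← ht, ExteriorAlgebra.ι_sq_zero]
  have hτc (x : ExteriorAlgebra S M) : ∃ y, x * τ = τ * y := by
    refine ⟨CliffordAlgebra.involute x, ?_⟩
    rw [← ht]
    induction x using ExteriorAlgebra.induction with
    | algebraMap r => rw [AlgHom.commutes, Algebra.commutes]
    | ι x =>
      rw [show CliffordAlgebra.involute (ExteriorAlgebra.ι S x) = -ExteriorAlgebra.ι S x from
        CliffordAlgebra.involute_ι x, mul_neg]
      exact eq_neg_of_add_eq_zero_left (ExteriorAlgebra.ι_add_mul_swap _ _)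
    | mul x y hx hy => rw [mul_assoc, hy, ← mul_assoc, hx, map_mul, mul_assoc]
    | add x y hx hy => rw [map_add, add_mul, mul_add, hx, hy]
  have unitMul (X Y : Matrix Unit Unit (ExteriorAlgebra S M)) :
      (X * Y) () () = X () () * Y () () := by simp [Matrix.mul_apply]
  have hα (i : ℕ) : PoleFiltration p τ (i + 1) (p ^ i • (β * ρ ^ i * c) () ()) := by
    match i with
    | 0 => simpa using PoleFiltration.self
    | 1 => simpa [hα2] using PoleFiltration.zero _
    | 2 => simpa [hα3] using PoleFiltration.zero _
    | i + 3 => exact PoleFiltration.of_pow_smul (by lia) _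
  -- expand the letters of `W ^ j` from the left; each letter `c * β` splits off a factor
  have hαW (j : ℕ) :
      ∀ i, PoleFiltration p τ (i + j + 1) (p ^ i • (β * ρ ^ i * W ^ j * c) () ()) := by
    induction j with
    | zero => simpa using hα
    | succ j ih =>
      intro i
      have e : p ^ i • (β * ρ ^ i * W ^ (j + 1) * c) () ()
          = p ^ (i + 1) • (β * ρ ^ (i + 1) * W ^ j * c) () ()
            + p ^ i • (β * ρ ^ i * c) () () *
              (p ^ 0 • (β * ρ ^ 0 * W ^ j * c : Matrix Unit Unit _) () ()) := by
        have : β * ρ ^ i * W ^ (j + 1) * c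
            = p • (β * ρ ^ (i + 1) * W ^ j * c) + (β * ρ ^ i * c) * (β * W ^ j * c) := by
          rw [pow_succ' W, pow_succ ρ]
          nth_rw 1 [hW]
          simp only [Matrix.mul_add, Matrix.add_mul, Matrix.mul_assoc, Matrix.smul_mul,
            Matrix.mul_smul]
        rw [this, Matrix.add_apply, Matrix.smul_apply, unitMul, smul_add, smul_smul, ← pow_succ,
          pow_zero, pow_zero, one_smul, Matrix.mul_one, smul_mul_assoc]
      rw [e]
      refine PoleFiltration.add ?_ ?_
      · rw [show i + (j + 1) + 1 = i + 1 + j + 1 by lia]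
        exact ih (i + 1)
      · rw [show i + (j + 1) + 1 = (i + 1) + (0 + j + 1) by lia]
        exact (hα i).mul (by lia) (by lia) hττ hτc (ih 0)
  -- expand the last letter of `W ^ j`; a letter `c * β` turns the trace into a product of forms
  have htr (j : ℕ) : ∀ i, i + j = 4 * k + 1 →
      ∃ N, p ^ i • (W ^ j * ρ ^ i).trace = p ^ (3 * k) • N := by
    induction j with
    | zero =>
      intro i hi
      exact ⟨p ^ (k + 1) • (W ^ 0 * ρ ^ i).trace, by
        rw [smul_smul, ← pow_add]; congr 2; lia⟩
    | succ j ih =>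
      intro i hi
      obtain ⟨N, hN⟩ := ih (i + 1) (by lia)
      have hV := hαW j i
      rw [show i + j + 1 = 4 * k + 1 by lia] at hV
      obtain ⟨N', hN'⟩ := hV.exists_eq_pow_smul
      have e : W ^ (j + 1) * ρ ^ i = p • (W ^ j * ρ ^ (i + 1)) + (W ^ j * c) * (β * ρ ^ i) := by
        rw [pow_succ W, pow_succ' ρ]
        nth_rw 2 [hW]
        simp only [Matrix.mul_add, Matrix.add_mul, Matrix.mul_assoc, Matrix.smul_mul,
          Matrix.mul_smul]
      have e' : ((W ^ j * c) * (β * ρ ^ i)).trace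
          = (-1) ^ ((j * 1 + 0) * (1 + i * 1)) *
            (β * ρ ^ i * W ^ j * c : Matrix Unit Unit _) () () := by
        rw [trace_mul_comm_of_mem_exteriorPower
          (matrix_mul_mem_exteriorPower (matrix_pow_mem_exteriorPower dW j) dc)
          (matrix_mul_mem_exteriorPower dβ (matrix_pow_mem_exteriorPower dρ i))]
        simp only [Matrix.mul_assoc, Matrix.trace, Matrix.diag_apply, Finset.univ_unique,
          Finset.sum_singleton, PUnit.default_eq_unit]
      refine ⟨N + (-1) ^ ((j * 1 + 0) * (1 + i * 1)) * N', ?_⟩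
      rw [e, Matrix.trace_add, Matrix.trace_smul, smul_add, smul_smul, ← pow_succ, hN, e',
        ← mul_smul_comm, hN', mul_smul_comm, smul_add]
  simpa using htr (4 * k + 1) 0 (by lia)

/-- If `B = p R + a aᵀ` with `R` symmetric, then `tr ((B θ) ^ (4 k + 1))` is divisible by
`p ^ (3 k)` for every symmetric matrix `θ` of one-forms. A word in `R θ` and `a aᵀ θ` is a product
of the forms `α_d = aᵀ θ (R θ) ^ (d - 1) a`, and `α₁² = α₂ = α₃ = 0`. -/
theorem exists_trace_eq_pow_smul_of_rank_one [DecidableEq n] (h2 : IsUnit (2 : S)) (p : S)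
    (B R : Matrix n n S) (hR : R.IsSymm) (a : n → S) (hB : B = p • R + Matrix.vecMulVec a a)
    (θ : Matrix n n M) (hθ : θ.IsSymm) (k : ℕ) :
    ∃ N, ((B.map (algebraMap S (ExteriorAlgebra S M)) * θ.map (ExteriorAlgebra.ι S)) ^
      (4 * k + 1)).trace = p ^ (3 * k) • N := by
  set Θ : Matrix n n (ExteriorAlgebra S M) := θ.map (ExteriorAlgebra.ι S) with hΘ
  set R' : Matrix n n (ExteriorAlgebra S M) := R.map (algebraMap S _) with hR'
  set c : Matrix n Unit (ExteriorAlgebra S M) := Matrix.of fun i _ => algebraMap S _ (a i) with hc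
  set β : Matrix Unit n (ExteriorAlgebra S M) := c.transpose * Θ with hβ
  have dΘ (i j) : Θ i j ∈ ⋀[S]^1 M := ι_mem_exteriorPower _
  have dc (i j) : c i j ∈ ⋀[S]^0 M := algebraMap_mem_exteriorPower _
  have hBW : B.map (algebraMap S (ExteriorAlgebra S M)) * Θ = p • (R' * Θ) + c * β := by
    have : B.map (algebraMap S (ExteriorAlgebra S M)) = p • R' + c * c.transpose := by
      ext i j
      rw [Matrix.add_apply, Matrix.smul_apply, Algebra.smul_def]
      simp only [hB, Matrix.map_apply, Matrix.add_apply, Matrix.smul_apply, smul_eq_mul, map_add,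
        map_mul, Matrix.vecMulVec_apply, Matrix.mul_apply, Matrix.transpose_apply, hc, hR',
        Matrix.of_apply, Finset.univ_unique, Finset.sum_singleton]
    rw [this, add_mul, smul_mul_assoc, hβ, Matrix.mul_assoc]
  rw [hBW]
  -- the one-forms `b = θ a`
  set b : n → M := fun i => ∑ j, a j • θ i j with hb
  have hΘc (i) (u : Unit) : (Θ * c) i u = ExteriorAlgebra.ι S (b i) := by
    simp only [hΘ, hc, hb, Matrix.mul_apply, Matrix.map_apply, Matrix.of_apply, map_sum, map_smul,
      Algebra.smul_def, Algebra.commutes]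
  have hβb (i) (u : Unit) : β u i = ExteriorAlgebra.ι S (b i) := by
    simp only [hβ, hΘ, hc, hb, Matrix.mul_apply, Matrix.map_apply, Matrix.of_apply, map_sum,
      map_smul, Algebra.smul_def, Matrix.transpose_apply, hθ.apply]
  refine exists_trace_pow_eq_pow_smul p (fun i j => ?_) dc (fun i j => ?_) ?_ ?_ k
  · exact matrix_mul_mem_exteriorPower (a := 0) (b := 1)
      (fun i j => algebraMap_mem_exteriorPower (R i j)) dΘ i j
  · rw [hβb]; exact ι_mem_exteriorPower _
  · have e : β * (R' * Θ) * c = β * R' * (Θ * c) := by simp only [Matrix.mul_assoc]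
    rw [e, Matrix.mul_apply]
    simp only [hΘc, Matrix.mul_apply (M := β), hβb, hR', Matrix.map_apply, Finset.sum_mul]
    rw [Finset.sum_comm]
    exact sum_ι_mul_algebraMap_mul_ι_eq_zero h2 R hR b
  · have e : β * (R' * Θ) ^ 2 * c = β * (R' * Θ * R') * (Θ * c) := by
      simp only [pow_two, Matrix.mul_assoc]
    have e' (i j) : (R' * Θ * R') i j
        = ExteriorAlgebra.ι S ((Matrix.of fun i j => ∑ x, ∑ y, (R y j * R i x) • θ x y) i j) := by
      simp only [hΘ, hR', Matrix.mul_apply, Matrix.map_apply, Matrix.of_apply, map_sum, map_smul,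
        Finset.sum_mul, mul_smul, Algebra.smul_def, Algebra.commutes]
      rw [Finset.sum_comm]
    rw [e, Matrix.mul_apply]
    simp only [hΘc, Matrix.mul_apply (M := β), hβb, e', Finset.sum_mul]
    rw [Finset.sum_comm]
    refine sum_ι_mul_ι_mul_ι_eq_zero h2 _ ?_ b
    ext i j
    simp only [Matrix.transpose_apply, Matrix.of_apply]
    rw [Finset.sum_comm]
    refine Finset.sum_congr rfl fun x _ => Finset.sum_congr rfl fun y _ => ?_
    rw [hθ.apply, hR.apply i x, hR.apply y j, mul_comm]

end RankOne

/-! ### The adjugate modulo the determinant -/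

section Adjugate

variable {S : Type*} [CommRing S] {n : Type*} [Fintype n] [DecidableEq n]

open Polynomial in
/-- The derivative at `s = 0` of `det (X + s u uᵀ)`. -/
noncomputable def detDeriv (X : Matrix n n S) (u : n → S) : S :=
  (X.map C + (Polynomial.X : S[X]) • (Matrix.vecMulVec u u).map C).det.coeff 1

open Polynomial in
/-- For a symmetric matrix, the adjugate has rank one modulo the determinant up to the scalar
`detDeriv X u`. The matrix `R` is the derivative at `s = 0` of the adjugate of `X + s u uᵀ`. -/
theorem exists_detDeriv_smul_adjugate_eq (X : Matrix n n S) (hX : X.IsSymm) (u : n → S) :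
    ∃ R : Matrix n n S, R.IsSymm ∧ detDeriv X u • X.adjugate = X.det • R +
      Matrix.vecMulVec (X.adjugate.mulVec u) (X.adjugate.mulVec u) := by
  set Y : Matrix n n S[X] := X.map C + (Polynomial.X : S[X]) • (Matrix.vecMulVec u u).map C with hY
  have hYs : Y.transpose = Y := by
    ext1 i j
    simp only [hY, Matrix.transpose_apply, Matrix.add_apply, Matrix.map_apply, Matrix.smul_apply,
      Matrix.vecMulVec_apply, hX.apply, mul_comm (u i)]
  have hA0 (i j) : (Y.adjugate i j).coeff 0 = X.adjugate i j := by
    have h1 : constantCoeff.mapMatrix Y.adjugate = (constantCoeff.mapMatrix Y).adjugate :=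
      RingHom.map_adjugate _ _
    have h2 : constantCoeff.mapMatrix Y = X := by
      ext1 i j
      simp [hY]
    rw [h2] at h1
    simpa using congrFun (congrFun h1 i) j
  have hAs : X.adjugate.transpose = X.adjugate := by
    rw [Matrix.adjugate_transpose, hX]
  refine ⟨Y.adjugate.map fun p => p.coeff 1, ?_, ?_⟩
  · rw [Matrix.IsSymm, ← Matrix.transpose_map, Matrix.adjugate_transpose, hYs]
  -- `adj X * Y * adj Y`, computed in two ways; the coefficient of `s` gives the claim
  have key : (C X.det • (1 : Matrix n n S[X]) + (Polynomial.X : S[X]) •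
      (Matrix.vecMulVec (X.adjugate.mulVec u) u).map C) * Y.adjugate
        = Y.det • X.adjugate.map C := by
    have h1 : X.adjugate.map C * Y = C X.det • (1 : Matrix n n S[X]) + (Polynomial.X : S[X]) •
        (Matrix.vecMulVec (X.adjugate.mulVec u) u).map C := by
      rw [hY, Matrix.mul_add, ← Matrix.map_mul, Matrix.adjugate_mul, Matrix.mul_smul,
        ← Matrix.map_mul, Matrix.mul_vecMulVec]
      congr 1
      ext1 i j
      simp [Matrix.one_apply, apply_ite C]
    rw [← h1, Matrix.mul_assoc, Matrix.mul_adjugate, Matrix.mul_smul, Matrix.mul_one]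
  rw [Matrix.add_mul, Matrix.smul_mul, Matrix.one_mul, Matrix.smul_mul] at key
  ext1 i j
  have hij := congrArg (fun p : S[X] => p.coeff 1) (congrFun (congrFun key i) j)
  have hu : ∑ l, u l * X.adjugate l j = X.adjugate.mulVec u j := by
    rw [Matrix.mulVec, dotProduct]
    refine Finset.sum_congr rfl fun l _ => ?_
    rw [← hAs, Matrix.transpose_apply, hAs, mul_comm]
  simp only [Matrix.add_apply, Matrix.smul_apply,
    smul_eq_mul, coeff_add, coeff_C_mul, coeff_X_mul, coeff_mul_C, Matrix.map_apply,
    Matrix.mul_apply, finsetSum_coeff, hA0, Matrix.vecMulVec_apply, mul_assoc, ← Finset.mul_sum,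
    hu] at hij
  simp only [Matrix.add_apply, Matrix.smul_apply, Matrix.map_apply, smul_eq_mul,
    Matrix.vecMulVec_apply]
  exact hij.symm

open Polynomial in
theorem map_detDeriv {T : Type*} [CommRing T] (φ : S →+* T) (X : Matrix n n S) (u : n → S) :
    φ (detDeriv X u) = detDeriv (X.map φ) (φ ∘ u) := by
  rw [detDeriv, detDeriv, ← coeff_map, ← coe_mapRingHom, RingHom.map_det]
  congr 2
  ext1 i j
  simp [Matrix.vecMulVec_apply]

open Polynomial in
/-- For a diagonal matrix with distinct entries `y + d i` the determinant is coprime to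
`detDeriv`: modulo `y + d i`, the latter is the product of the other diagonal entries. -/
theorem isCoprime_detDeriv_diagonal {K : Type*} [Field K] (d : n → K)
    (hd : Function.Injective d) :
    IsCoprime (Matrix.diagonal fun i => (X + C (d i) : K[X])).det
      (detDeriv (Matrix.diagonal fun i => (X + C (d i) : K[X])) 1) := by
  set D : Matrix n n K[X] := Matrix.diagonal fun i => (X + C (d i) : K[X]) with hD
  obtain ⟨R, -, hR⟩ := exists_detDeriv_smul_adjugate_eq D (Matrix.isSymm_diagonal _) 1
  rw [hD, Matrix.det_diagonal, ← hD]
  refine IsCoprime.prod_left fun i _ => ?_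
  have hcop (i j : n) (hij : i ≠ j) : IsCoprime (X + C (d i)) (X + C (d j)) := by
    have := pairwise_coprime_X_sub_C (s := fun i => -d i) (neg_injective.comp hd) hij
    simpa [Function.onFun] using this
  set a : K[X] := ∏ j ∈ Finset.univ.erase i, (X + C (d j)) with ha
  have hai : IsCoprime (X + C (d i)) a :=
    IsCoprime.prod_right fun j hj => hcop i j (Finset.ne_of_mem_erase hj).symm
  have ha0 : a ≠ 0 := Finset.prod_ne_zero_iff.2 fun j _ => (monic_X_add_C _).ne_zero
  have e := congrFun (congrFun hR i) i
  have hadj : D.adjugate = Matrix.diagonal fun i => ∏ j ∈ Finset.univ.erase i, (X + C (d j)) := by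
    rw [hD, Matrix.adjugate_diagonal]
  have hdet : D.det = (X + C (d i)) * a := by
    rw [hD, Matrix.det_diagonal, ha,
      Finset.mul_prod_erase _ (fun j => (X + C (d j) : K[X])) (Finset.mem_univ i)]
  simp only [Matrix.smul_apply, Matrix.add_apply, smul_eq_mul, Matrix.vecMulVec_apply, hadj,
    Matrix.diagonal_apply_eq, Matrix.mulVec_diagonal, Pi.one_apply, mul_one, hdet, ← ha] at e
  have e' : detDeriv D 1 = (X + C (d i)) * R i i + a := by
    refine mul_right_cancel₀ ha0 (e.trans ?_)
    ring
  rw [e']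
  exact (IsCoprime.mul_add_left_right_iff).2 hai

open Polynomial in
/-- If a monic polynomial `P` becomes coprime to `Q` after a specialisation of the coefficients
in a domain `R` to a field, then `Q` is a nonzerodivisor modulo `P`: the resultant of `P` and `Q` is
a nonzero element of `R` in the ideal generated by `P` and `Q`. -/
theorem dvd_of_dvd_mul_of_isCoprime_map {R K : Type*} [CommRing R] [IsDomain R] [Field K]
    (φ : R →+* K) {P Q : R[X]} (hP : P.Monic) (h : IsCoprime (P.map φ) (Q.map φ)) {f : R[X]}
    (hf : P ∣ Q * f) : P ∣ f := by
  by_cases h0 : P.natDegree = 0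
  · rw [eq_one_of_monic_natDegree_zero hP h0]; exact one_dvd f
  obtain ⟨p, q, -, -, e⟩ :=
    exists_mul_add_mul_eq_C_resultant P Q le_rfl le_rfl (Or.inl h0)
  set r := P.resultant Q P.natDegree Q.natDegree with hr
  have hr0 : r ≠ 0 := by
    intro h0
    have h1 : (P.map φ).resultant (Q.map φ) P.natDegree Q.natDegree = 0 := by
      rw [resultant_map_map, ← hr, h0, map_zero]
    obtain ⟨k, hk⟩ := Nat.exists_eq_add_of_le (natDegree_map_le (f := φ) (p := Q))
    rw [hk, resultant_add_right_deg _ _ _ _ _ le_rfl, ← hP.natDegree_map φ,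
      (hP.map φ).coeff_natDegree, one_pow, one_mul] at h1
    exact resultant_ne_zero _ _ h h1
  have h1 : P ∣ C r * f := by
    obtain ⟨w, hw⟩ := hf
    exact ⟨p * f + w * q, by rw [← e]; linear_combination q * hw⟩
  rw [← modByMonic_eq_zero_iff_dvd hP] at h1 ⊢
  rw [← smul_eq_C_mul, smul_modByMonic, smul_eq_zero] at h1
  exact h1.resolve_left hr0

end Adjugate

/-! ### The order of the pole of the invariant trace of a symmetric matrix -/

section Pole

/-- If `Q` is a nonzerodivisor modulo `P`, powers of `Q` are nonzerodivisors modulo powers of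
`P`. -/
theorem pow_dvd_of_pow_dvd_pow_mul {S : Type*} [CommRing S] [IsDomain S] {P Q : S} (hP : P ≠ 0)
    (h : ∀ f, P ∣ Q * f → P ∣ f) (a b : ℕ) {f : S} (hf : P ^ a ∣ Q ^ b * f) : P ^ a ∣ f := by
  have h1 (b : ℕ) : ∀ f, P ∣ Q ^ b * f → P ∣ f := by
    induction b with
    | zero => simp
    | succ b ih => exact fun f hf => ih f (h _ (by rwa [← mul_assoc, ← pow_succ']))
  induction a generalizing f with
  | zero => simp
  | succ a ih =>
    obtain ⟨f, rfl⟩ := h1 b f ((dvd_pow_self P a.succ_ne_zero).trans hf)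
    rw [pow_succ'] at hf ⊢
    rw [mul_left_comm] at hf
    exact mul_dvd_mul_left P (ih ((mul_dvd_mul_iff_left hP).1 hf))

theorem free_exteriorAlgebra (S M : Type*) [CommRing S] [AddCommGroup M] [Module S M]
    [Module.Free S M] : Module.Free S (ExteriorAlgebra S M) := by
  classical
  let I := Module.Free.ChooseBasisIndex S M
  let _ : LinearOrder I := linearOrderOfSTO WellOrderingRel
  exact Module.Free.of_basis (Module.Free.chooseBasis S M).ExteriorAlgebra

/-- In a free module, divisibility by powers of `P` may be tested after multiplication by a power of
a nonzerodivisor `Q` modulo `P`. -/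
theorem exists_eq_pow_smul_of_pow_smul_eq {S F : Type*} [CommRing S] [IsDomain S]
    [AddCommGroup F] [Module S F] [Module.Free S F] {P Q : S} (hP : P ≠ 0)
    (h : ∀ f, P ∣ Q * f → P ∣ f) {a b : ℕ} {x y : F} (hxy : Q ^ b • x = P ^ a • y) :
    ∃ z, x = P ^ a • z := by
  let B := Module.Free.chooseBasis S F
  have hc (i) : P ^ a ∣ B.repr x i := by
    refine pow_dvd_of_pow_dvd_pow_mul hP h a b ⟨B.repr y i, ?_⟩
    rw [← smul_eq_mul, ← smul_eq_mul, ← Finsupp.smul_apply, ← Finsupp.smul_apply, ← map_smul,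
      ← map_smul, hxy]
  choose c hc using hc
  refine ⟨∑ i ∈ (B.repr x).support, c i • B i, ?_⟩
  rw [Finset.smul_sum]
  conv_lhs => rw [← B.linearCombination_repr x, Finsupp.linearCombination_apply, Finsupp.sum]
  exact Finset.sum_congr rfl fun i _ => by rw [smul_smul, ← hc]

variable {n : Type*} [Fintype n] [DecidableEq n]

open Polynomial in
/-- Divisibility of the trace for the matrix `Z + y`, where `Z` is the generic symmetric matrix, and
any symmetric matrix with entries in a free module. The variable `y` makes the determinant a monic
polynomial; it is coprime to `detDeriv` by specialisation to diagonal matrices. -/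
theorem exists_trace_generic_eq (k : ℕ) (Z : Matrix n n (MvPolynomial (n × n) ℚ))
    (hZ : ∀ i j, Z i j = MvPolynomial.X (i, j) + MvPolynomial.X (j, i))
    {M : Type*} [AddCommGroup M] [Module (MvPolynomial (n × n) ℚ)[X] M]
    [Module.Free (MvPolynomial (n × n) ℚ)[X] M] (θ : Matrix n n M) (hθ : θ.IsSymm) :
    ∃ N : ExteriorAlgebra (MvPolynomial (n × n) ℚ)[X] M,
      (((-Z).charmatrix.adjugate.map
        (algebraMap _ (ExteriorAlgebra (MvPolynomial (n × n) ℚ)[X] M)) *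
        θ.map (ExteriorAlgebra.ι (MvPolynomial (n × n) ℚ)[X])) ^ (4 * k + 1)).trace
        = (-Z).charmatrix.det ^ (3 * k) • N := by
  set Y := (-Z).charmatrix with hY
  have hYs : Y.IsSymm := by
    ext1 i j
    simp only [hY, Matrix.charmatrix, Matrix.transpose_apply, Matrix.sub_apply, Matrix.scalar_apply,
      Matrix.diagonal_apply, eq_comm (a := j), RingHom.mapMatrix_apply, Matrix.map_apply,
      Matrix.neg_apply, hZ, add_comm (MvPolynomial.X (j, i))]
  have hmon : Y.det.Monic := (-Z).charpoly_monic
  obtain ⟨R, hR, e⟩ := exists_detDeriv_smul_adjugate_eq Y hYs 1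
  set g := detDeriv Y 1
  have h2 : IsUnit (2 : (MvPolynomial (n × n) ℚ)[X]) := by
    rw [← map_ofNat (algebraMap ℚ (MvPolynomial (n × n) ℚ)[X]) 2]
    exact (IsUnit.mk0 (2 : ℚ) two_ne_zero).map _
  obtain ⟨N, hN⟩ := exists_trace_eq_pow_smul_of_rank_one h2 Y.det _ R hR _ e θ hθ k
  have hF := free_exteriorAlgebra (MvPolynomial (n × n) ℚ)[X] M
  refine exists_eq_pow_smul_of_pow_smul_eq (Q := g) (b := 4 * k + 1) hmon.ne_zero ?_ (y := N) ?_
  · -- specialise `Z` to a diagonal matrix with distinct entries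
    set d : n → ℚ := fun i => ((Fintype.equivFin n i : ℕ) : ℚ) with hd
    have hdi : Function.Injective d := fun i j hij => by
      simpa [hd, Fin.val_inj] using hij
    let φ : MvPolynomial (n × n) ℚ →+* ℚ :=
      (MvPolynomial.aeval (R := ℚ) fun p : n × n => if p.1 = p.2 then d p.1 / 2 else 0).toRingHom
    have hφ : Y.map (mapRingHom φ) = Matrix.diagonal fun i => (X + C (d i) : ℚ[X]) := by
      have hφZ (i j) : φ (Z i j) = if i = j then d i else 0 := by
        by_cases h : i = j
        · subst h; simp [φ, hZ]
        · simp [φ, hZ, h, Ne.symm h]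
      ext1 i j
      by_cases h : i = j
      · subst h
        simp [hY, Matrix.charmatrix_apply_eq, hφZ]
      · simp [hY, hφZ, h]
    have hcop := isCoprime_detDeriv_diagonal d hdi
    rw [← hφ] at hcop
    refine fun f => dvd_of_dvd_mul_of_isCoprime_map φ hmon ?_
    rw [← coe_mapRingHom, RingHom.map_det, map_detDeriv]
    have h1 : mapRingHom φ ∘ (1 : n → (MvPolynomial (n × n) ℚ)[X]) = 1 :=
      _root_.funext fun _ => map_one (mapRingHom φ)
    rwa [h1, RingHom.mapMatrix_apply]
  · rw [← hN]
    have : (g • Y.adjugate).map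
        (algebraMap (MvPolynomial (n × n) ℚ)[X] (ExteriorAlgebra (MvPolynomial (n × n) ℚ)[X] M))
        = g • (Y.adjugate.map (algebraMap _ (ExteriorAlgebra (MvPolynomial (n × n) ℚ)[X] M))) := by
      ext1 i j
      rw [Matrix.map_apply, Matrix.smul_apply, Matrix.smul_apply, smul_eq_mul, map_mul,
        Algebra.smul_def, Matrix.map_apply]
    rw [this, smul_mul_assoc, _root_.smul_pow, Matrix.trace_smul]

section Specialise

variable {S A M M' : Type*} [CommRing S] [CommRing A] [Algebra S A] [AddCommGroup M] [Module S M]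
  [AddCommGroup M'] [Module A M'] [Module S M'] [IsScalarTower S A M']

/-- Divisibility of the trace is preserved by a change of rings and of modules. -/
theorem exists_trace_map_eq (B : Matrix n n S) (θ : Matrix n n M) (L : M →ₗ[S] M')
    {p : S} {a m : ℕ} (h : ∃ N, ((B.map (algebraMap S (ExteriorAlgebra S M)) *
      θ.map (ExteriorAlgebra.ι S)) ^ m).trace = p ^ a • N) :
    ∃ N, (((B.map (algebraMap S A)).map (algebraMap A (ExteriorAlgebra A M')) *
      (θ.map L).map (ExteriorAlgebra.ι A)) ^ m).trace = algebraMap S A p ^ a • N := by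
  obtain ⟨N, hN⟩ := h
  let l : M →ₗ[S] ExteriorAlgebra A M' := ((ExteriorAlgebra.ι A).restrictScalars S).comp L
  have hl (m) : l m * l m = 0 := ExteriorAlgebra.ι_sq_zero _
  let g : ExteriorAlgebra S M →ₐ[S] ExteriorAlgebra A M' := ExteriorAlgebra.lift S ⟨l, hl⟩
  refine ⟨g N, ?_⟩
  have h1 := congrArg g hN
  rw [map_smul, ← algebraMap_smul A, map_pow] at h1
  rw [← h1, ← AlgHom.coe_toRingHom, AddMonoidHom.map_trace]
  change _ = ((g : ExteriorAlgebra S M →+* ExteriorAlgebra A M').mapMatrix _).trace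
  rw [map_pow, map_mul]
  congr 3
  · ext1 i j
    simp only [Matrix.map_apply, RingHom.mapMatrix_apply, RingHom.coe_coe, AlgHom.commutes]
    exact (IsScalarTower.algebraMap_apply S A (ExteriorAlgebra A M') _).symm
  · ext1 i j
    simp only [Matrix.map_apply, RingHom.mapMatrix_apply, RingHom.coe_coe]
    exact (ExteriorAlgebra.lift_ι_apply S l hl (θ i j)).symm

end Specialise

/-- For symmetric matrices `X` of functions and `θ` of one-forms, the form
`tr ((X⁻¹ θ) ^ (4 k + 1))` has a pole of order at most `k + 1` along `det X = 0`: in terms of the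
adjugate of `X`, the trace is divisible by `(det X) ^ (3 k)`. -/
theorem exists_trace_adjugate_eq {A M : Type*} [CommRing A] [Algebra ℚ A] [AddCommGroup M]
    [Module A M] (X : Matrix n n A) (hX : X.IsSymm) (θ : Matrix n n M) (hθ : θ.IsSymm) (k : ℕ) :
    ∃ N ∈ ⋀[A]^(4 * k + 1) M, ((X.adjugate.map (algebraMap A (ExteriorAlgebra A M)) *
      θ.map (ExteriorAlgebra.ι A)) ^ (4 * k + 1)).trace = X.det ^ (3 * k) • N := by
  -- the degree of the quotient need not be tracked: project to the degree of the trace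
  suffices h : ∃ N, ((X.adjugate.map (algebraMap A (ExteriorAlgebra A M)) *
      θ.map (ExteriorAlgebra.ι A)) ^ (4 * k + 1)).trace = X.det ^ (3 * k) • N by
    obtain ⟨N, hN⟩ := h
    refine ⟨GradedAlgebra.proj (fun i : ℕ => ⋀[A]^i M) (4 * k + 1) N, SetLike.coe_mem _, ?_⟩
    rw [← map_smul, ← hN, GradedAlgebra.proj_apply, DirectSum.decompose_of_mem_same]
    refine Submodule.sum_mem _ fun i _ => ?_
    have := matrix_pow_mem_exteriorPower (matrix_mul_mem_exteriorPower (a := 0) (b := 1)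
      (A := X.adjugate.map (algebraMap A (ExteriorAlgebra A M)))
      (B := θ.map (ExteriorAlgebra.ι A))
      (fun i j => algebraMap_mem_exteriorPower _) (fun i j => ι_mem_exteriorPower _))
      (4 * k + 1) i i
    simpa using this
  let Z : Matrix n n (MvPolynomial (n × n) ℚ) :=
    Matrix.of fun i j => MvPolynomial.X (i, j) + MvPolynomial.X (j, i)
  -- specialise the generic matrix `Z + y` to `X` by `y ↦ 0`; the generic entries of `Z` are
  -- `z_ij + z_ji`, so the variables go to half of the entries of `X`
  let half : A := algebraMap ℚ A (1 / 2)
  have hhalf : half + half = 1 := by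
    rw [← map_add, ← map_one (algebraMap ℚ A)]; norm_num
  let φ₀ : MvPolynomial (n × n) ℚ →+* A :=
    (MvPolynomial.aeval (R := ℚ) fun p : n × n => half * X p.1 p.2).toRingHom
  let φ : Polynomial (MvPolynomial (n × n) ℚ) →+* A := Polynomial.eval₂RingHom φ₀ 0
  let _ : Algebra (Polynomial (MvPolynomial (n × n) ℚ)) A := φ.toAlgebra
  let _ : Module (Polynomial (MvPolynomial (n × n) ℚ)) M := Module.compHom M φ
  have _ : IsScalarTower (Polynomial (MvPolynomial (n × n) ℚ)) A M := ⟨fun s a m => by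
    rw [Algebra.smul_def, mul_smul]; rfl⟩
  let θ₀ : Matrix n n (n × n →₀ Polynomial (MvPolynomial (n × n) ℚ)) :=
    Matrix.of fun i j => Finsupp.single (i, j) 1 + Finsupp.single (j, i) 1
  have hθ₀ : θ₀.IsSymm := by ext1 i j; exact add_comm _ _
  let L : (n × n →₀ Polynomial (MvPolynomial (n × n) ℚ)) →ₗ[Polynomial (MvPolynomial (n × n) ℚ)] M :=
    Finsupp.linearCombination (Polynomial (MvPolynomial (n × n) ℚ))
      fun p : n × n => half • θ p.1 p.2
  have hL : θ₀.map L = θ := by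
    ext1 i j
    simp only [θ₀, L, Matrix.map_apply, Matrix.of_apply, map_add,
      Finsupp.linearCombination_single, one_smul, hθ.apply]
    rw [← add_smul, hhalf, one_smul]
  have hφX : (-Z).charmatrix.map (algebraMap (Polynomial (MvPolynomial (n × n) ℚ)) A) = X := by
    ext1 i j
    change φ ((-Z).charmatrix i j) = X i j
    simp only [φ, φ₀, Z, Matrix.charmatrix, Matrix.sub_apply, Matrix.scalar_apply,
      RingHom.mapMatrix_apply, Matrix.map_apply, Matrix.neg_apply, Matrix.of_apply, map_neg,
      sub_neg_eq_add, map_add, Polynomial.coe_eval₂RingHom, Polynomial.eval₂_C,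
      AlgHom.toRingHom_eq_coe, RingHom.coe_coe, MvPolynomial.aeval_X, hX.apply]
    rw [← add_mul, hhalf, one_mul, Matrix.diagonal_apply]
    split_ifs <;> simp
  have := exists_trace_map_eq (A := A) (-Z).charmatrix.adjugate θ₀ L
    (exists_trace_generic_eq k Z (fun _ _ => rfl) θ₀ hθ₀)
  rwa [hL, RingHom.map_det, RingHom.mapMatrix_apply, hφX,
    ← RingHom.mapMatrix_apply (algebraMap (Polynomial (MvPolynomial (n × n) ℚ)) A),
    RingHom.map_adjugate, RingHom.mapMatrix_apply, hφX] at this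

end Pole

/-! ### Calculus of invariant traces -/

section Calculus

variable {k A B : Type*} [CommRing k] [CommRing A] [CommRing B] [Algebra k A] [Algebra k B]
variable {n m : Type*} [Fintype n] [DecidableEq n] [Fintype m] [DecidableEq m]

theorem dFun_mul (a b : A) : dFun k A (a * b) =
    algebraMap A _ a * dFun k A b + algebraMap A _ b * dFun k A a := by
  rw [dFun, Derivation.leibniz, map_add, map_smul, map_smul, Algebra.smul_def, Algebra.smul_def]
  rfl

theorem dFun_algebraMap (r : k) : dFun k A (algebraMap k A r) = 0 := by
  rw [dFun, Derivation.map_algebraMap, map_zero]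

theorem dFun_mem (a : A) : dFun k A a ∈ ⋀[A]^1 Ω[A⁄k] := ι_mem_exteriorPower _

theorem map_dFun_mul {p q l : Type*} [Fintype q] (X : Matrix p q A) (Y : Matrix q l A) :
    (X * Y).map (dFun k A) = X.map (algebraMap A (Forms k A)) * Y.map (dFun k A)
      + X.map (dFun k A) * Y.map (algebraMap A (Forms k A)) := by
  ext1 i j
  rw [Matrix.add_apply, Matrix.map_apply, Matrix.mul_apply, Matrix.mul_apply, Matrix.mul_apply,
    ← Finset.sum_add_distrib, dFun, map_sum, map_sum]
  refine Finset.sum_congr rfl fun x _ => ?_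
  rw [Matrix.map_apply, Matrix.map_apply, Matrix.map_apply, Matrix.map_apply, ← Algebra.commutes]
  exact dFun_mul _ _

theorem map_algebraMap_smul {p q : Type*} (a : A) (X : Matrix p q A) :
    (a • X).map (algebraMap A (Forms k A)) = a • X.map (algebraMap A (Forms k A)) := by
  ext1 i j
  rw [Matrix.map_apply, Matrix.smul_apply, Matrix.smul_apply, smul_eq_mul, map_mul,
    ← Algebra.smul_def, Matrix.map_apply]

theorem map_algebraMap_mul_eq_one {p q : Type*} [Fintype q] [DecidableEq p] {X : Matrix p q A}
    {Y : Matrix q p A} (h : X * Y = 1) :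
    X.map (algebraMap A (Forms k A)) * Y.map (algebraMap A (Forms k A)) = 1 := by
  rw [← Matrix.map_mul, h, Matrix.map_one _ (map_zero _) (map_one _)]

/-! #### Degree and sign -/

theorem maurerCartan_mem (X : Matrix n n A) (i j : n) :
    maurerCartan k X i j ∈ ⋀[A]^1 Ω[A⁄k] :=
  matrix_mul_mem_exteriorPower (a := 0) (b := 1) (fun _ _ => algebraMap_mem_exteriorPower _)
    (fun _ _ => dFun_mem _) i j

theorem invariantTrace_mem (X : Matrix n n A) (r : ℕ) :
    invariantTrace k X r ∈ ⋀[A]^r Ω[A⁄k] := by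
  refine Submodule.sum_mem _ fun i _ => ?_
  have := matrix_pow_mem_exteriorPower (maurerCartan_mem (k := k) X) r i i
  rwa [mul_one] at this

/-- The trace of an even power of a matrix of one-forms vanishes. -/
theorem trace_pow_even_eq_zero (h2 : IsUnit (2 : A)) {M : Type*} [AddCommGroup M] [Module A M]
    {μ : Matrix n n (ExteriorAlgebra A M)} (hμ : ∀ i j, μ i j ∈ ⋀[A]^1 M) {r : ℕ}
    (hr : Even r) (h0 : r ≠ 0) : (μ ^ r).trace = 0 := by
  obtain ⟨r, rfl⟩ := Nat.exists_eq_succ_of_ne_zero h0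
  have h := trace_mul_comm_of_mem_exteriorPower (matrix_pow_mem_exteriorPower hμ r) hμ
  rw [← pow_succ, ← pow_succ', mul_one, mul_one,
    (Nat.not_even_iff_odd.1 (Nat.even_add_one.1 hr)).neg_one_pow, neg_one_mul] at h
  have h' : (2 : A) • (μ ^ (r + 1)).trace = 0 := by
    rw [two_smul]; nth_rw 1 [h]; exact neg_add_cancel _
  exact (h2.smul_eq_zero).1 h'

/-! #### Functoriality -/

theorem map_formPullback_map_algebraMap {p q : Type*} (φ : A →ₐ[k] B) (X : Matrix p q A) :
    (X.map (algebraMap A (Forms k A))).map (formPullback φ)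
      = (X.map φ).map (algebraMap B (Forms k B)) := by
  ext1 i j
  exact formPullback_algebraMap φ _

theorem map_formPullback_map_dFun {p q : Type*} (φ : A →ₐ[k] B) (X : Matrix p q A) :
    (X.map (dFun k A)).map (formPullback φ) = (X.map φ).map (dFun k B) := by
  ext1 i j
  exact formPullback_dFun φ _

theorem formPullback_trace_pow (φ : A →ₐ[k] B) (X Y : Matrix n n A) (r : ℕ) :
    formPullback φ ((X.map (algebraMap A (Forms k A)) * Y.map (dFun k A)) ^ r).trace
      = (((X.map φ).map (algebraMap B (Forms k B)) * (Y.map φ).map (dFun k B)) ^ r).trace := by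
  have h : formPullback φ ((X.map (algebraMap A (Forms k A)) * Y.map (dFun k A)) ^ r).trace
      = ((formPullback φ : Forms k A →+* Forms k B).mapMatrix
        ((X.map (algebraMap A (Forms k A)) * Y.map (dFun k A)) ^ r)).trace :=
    AddMonoidHom.map_trace (formPullback φ : Forms k A →+* Forms k B) _
  rw [h, map_pow, map_mul, ← map_formPullback_map_algebraMap, ← map_formPullback_map_dFun]
  rfl

theorem map_inv_of_isUnit (φ : A →ₐ[k] B) (X : Matrix n n A) (hX : IsUnit X) :
    X⁻¹.map φ = (X.map φ)⁻¹ := by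
  symm
  apply Matrix.inv_eq_right_inv
  have : X * X⁻¹ = 1 := Matrix.mul_nonsing_inv X ((Matrix.isUnit_iff_isUnit_det X).1 hX)
  rw [← Matrix.map_mul, this, Matrix.map_one _ (map_zero φ) (map_one φ)]

theorem formPullback_invariantTrace (φ : A →ₐ[k] B) (X : Matrix n n A) (hX : IsUnit X) (r : ℕ) :
    formPullback φ (invariantTrace k X r) = invariantTrace k (X.map φ) r := by
  rw [invariantTrace, invariantTrace, maurerCartan, maurerCartan, formPullback_trace_pow,
    map_inv_of_isUnit φ X hX]

theorem formPullback_smul (φ : A →ₐ[k] B) (a : A) (w : Forms k A) :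
    formPullback φ (a • w) = φ a • formPullback φ w := by
  rw [Algebra.smul_def, map_mul, formPullback_algebraMap, ← Algebra.smul_def]

/-- Two `k`-algebra maps out of the algebra of forms which agree on functions and on exact
one-forms are equal. -/
theorem forms_algHom_ext {C : Type*} [Ring C] [Algebra k C] {f g : Forms k A →ₐ[k] C}
    (h0 : ∀ a, f (algebraMap A _ a) = g (algebraMap A _ a))
    (h1 : ∀ a, f (dFun k A a) = g (dFun k A a)) : f = g := by
  ext1 w
  induction w using ExteriorAlgebra.induction with
  | algebraMap r => exact h0 r
  | ι x =>
    have hx : x ∈ Submodule.span A (Set.range (KaehlerDifferential.D k A)) := by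
      rw [KaehlerDifferential.span_range_derivation]; trivial
    induction hx using Submodule.span_induction with
    | mem x hx => obtain ⟨a, rfl⟩ := hx; exact h1 a
    | zero => simp
    | add x y _ _ hx hy => rw [map_add, map_add, hx, hy, map_add]
    | smul a x _ hx => rw [map_smul, Algebra.smul_def, map_mul, map_mul, hx, h0]
  | mul a b ha hb => rw [map_mul, map_mul, ha, hb]
  | add a b ha hb => rw [map_add, map_add, ha, hb]

theorem formPullback_comp {C : Type*} [CommRing C] [Algebra k C] (ψ : B →ₐ[k] C) (φ : A →ₐ[k] B)
    (w : Forms k A) : formPullback ψ (formPullback φ w) = formPullback (ψ.comp φ) w := by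
  have : (formPullback ψ).comp (formPullback φ) = formPullback (ψ.comp φ) :=
    forms_algHom_ext (fun a => by simp [formPullback_algebraMap])
      fun a => by simp [formPullback_dFun]
  rw [← this]; rfl

theorem formPullback_id (w : Forms k A) : formPullback (AlgHom.id k A) w = w := by
  have : formPullback (AlgHom.id k A) = AlgHom.id k (Forms k A) :=
    forms_algHom_ext (fun a => by simp [formPullback_algebraMap])
      fun a => by simp [formPullback_dFun]
  rw [this]; rfl

/-! #### Closedness -/

theorem signInv_of_mem {r : ℕ} {w : Forms k A} (hw : w ∈ ⋀[A]^r Ω[A⁄k]) :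
    signInv k A w = (-1) ^ r * w := by
  induction hw using Submodule.pow_induction_on_left' with
  | algebraMap r => simp
  | add x y i _ _ hx hy => rw [map_add, hx, hy, mul_add]
  | mem_mul z hz i x _ hx =>
    obtain ⟨z, rfl⟩ := hz
    have hc : Commute (ExteriorAlgebra.ι A z) ((-1) ^ i) :=
      (Commute.one_right _).neg_right.pow_right i
    rw [map_mul, hx, signInv_ι, pow_succ, mul_assoc, neg_one_mul, ← mul_assoc, neg_mul, hc.eq,
      neg_mul, mul_neg, mul_assoc]

theorem map_extD_mul {p q l : Type*} [Fintype q] {r : ℕ} {X : Matrix p q (Forms k A)}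
    (hX : ∀ i j, X i j ∈ ⋀[A]^r Ω[A⁄k]) (Y : Matrix q l (Forms k A)) :
    (X * Y).map (extD k A) = X.map (extD k A) * Y + (-1 : ℤ) ^ r • (X * Y.map (extD k A)) := by
  ext1 i j
  simp only [Matrix.map_apply, Matrix.mul_apply, Matrix.add_apply, Matrix.smul_apply, map_sum,
    extD_mul, Finset.sum_add_distrib, Finset.smul_sum]
  congr 1
  refine Finset.sum_congr rfl fun x _ => ?_
  rw [signInv_of_mem (hX i x), mul_assoc, zsmul_eq_mul]
  push_cast
  rfl

/-- The Maurer–Cartan equation. -/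
theorem map_extD_maurerCartan (X : Matrix n n A) (hX : IsUnit X) :
    (maurerCartan k X).map (extD k A) = -(maurerCartan k X) ^ 2 := by
  have hd := (Matrix.isUnit_iff_isUnit_det X).1 hX
  have h1 := map_dFun_mul (k := k) X⁻¹ X
  rw [Matrix.nonsing_inv_mul X hd] at h1
  have h0 : (1 : Matrix n n A).map (dFun k A) = 0 := by
    ext1 i j
    rw [Matrix.map_apply, Matrix.one_apply, dFun]
    split_ifs <;> simp
  have hXX : X.map (algebraMap A (Forms k A)) * X⁻¹.map (algebraMap A (Forms k A)) = 1 :=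
    map_algebraMap_mul_eq_one (Matrix.mul_nonsing_inv X hd)
  have h2 : X⁻¹.map (dFun k A) = -(maurerCartan k X * X⁻¹.map (algebraMap A (Forms k A))) := by
    rw [h0] at h1
    have h3 := eq_neg_of_add_eq_zero_right h1.symm
    calc X⁻¹.map (dFun k A) = X⁻¹.map (dFun k A) * X.map (algebraMap A (Forms k A))
          * X⁻¹.map (algebraMap A (Forms k A)) := by
            rw [Matrix.mul_assoc, hXX, Matrix.mul_one]
      _ = _ := by rw [h3, Matrix.neg_mul, maurerCartan]
  have h3 : (X⁻¹.map (algebraMap A (Forms k A))).map (extD k A) = X⁻¹.map (dFun k A) := by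
    ext1 i j; exact extD_algebraMap _ _ _
  have h4 : (X.map (dFun k A)).map (extD k A) = 0 := by
    ext1 i j; exact extD_dFun _ _ _
  have h5 : (maurerCartan k X).map (extD k A) = X⁻¹.map (dFun k A) * X.map (dFun k A) := by
    have hX0 (i j) : X⁻¹.map (algebraMap A (Forms k A)) i j ∈ ⋀[A]^0 Ω[A⁄k] :=
      algebraMap_mem_exteriorPower _
    rw [maurerCartan, map_extD_mul hX0, h3, h4, Matrix.mul_zero, smul_zero, add_zero]
  rw [h5, h2, Matrix.neg_mul, Matrix.mul_assoc, pow_two]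
  rfl

/-- The invariant traces of odd degree are closed: by the Maurer–Cartan equation their
differentials are traces of even powers. -/
theorem extD_invariantTrace (h2 : IsUnit (2 : A)) (X : Matrix n n A) (hX : IsUnit X) (r : ℕ) :
    extD k A (invariantTrace k X (2 * r + 1)) = 0 := by
  set μ := maurerCartan k X with hμ
  have h1 : μ.map (extD k A) = -μ ^ 2 := map_extD_maurerCartan X hX
  have dμ := maurerCartan_mem (k := k) X
  have hsq : (μ ^ 2).map (extD k A) = 0 := by
    rw [pow_two, map_extD_mul dμ, h1, pow_one, neg_one_smul, neg_mul, mul_neg, neg_neg,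
      ← pow_succ, ← pow_succ', neg_add_cancel]
  have hev (r : ℕ) : (μ ^ (2 * r)).map (extD k A) = 0 := by
    induction r with
    | zero =>
      ext1 i j
      rw [Matrix.map_apply, Nat.mul_zero, pow_zero, Matrix.one_apply]
      split_ifs
      · rw [← map_one (algebraMap A (Forms k A)), extD_algebraMap, dFun]; simp
      · exact map_zero _
    | succ r ih =>
      rw [Nat.mul_succ, pow_add, map_extD_mul (matrix_pow_mem_exteriorPower dμ _), ih, hsq,
        zero_mul, Matrix.mul_zero, smul_zero, add_zero]
  have : extD k A (invariantTrace k X (2 * r + 1))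
      = ((μ ^ (2 * r + 1)).map (extD k A)).trace :=
    AddMonoidHom.map_trace (extD k A).toAddMonoidHom _
  rw [this, pow_succ, map_extD_mul (matrix_pow_mem_exteriorPower dμ _), hev, zero_mul, zero_add,
    h1, mul_neg, ← pow_add, Matrix.trace_smul, Matrix.trace_neg,
    trace_pow_even_eq_zero h2 dμ (by simp [parity_simps]) (by lia), neg_zero, smul_zero]

/-! #### Invariance -/

/-- Rescaling by a function `c` changes `X⁻¹ dX` by the scalar one-form `dc / c`, which
anticommutes with one-forms and squares to zero. -/
theorem invariantTrace_smul (h2 : IsUnit (2 : A)) (X : Matrix n n A) (hX : IsUnit X) {c : A}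
    (hc : IsUnit c) {r : ℕ} (hr : r ≠ 0) :
    invariantTrace k (c • X) (2 * r + 1) = invariantTrace k X (2 * r + 1) := by
  obtain ⟨c, rfl⟩ := hc
  have hd := (Matrix.isUnit_iff_isUnit_det X).1 hX
  set μ := maurerCartan k X with hμ
  have dμ : ∀ i j, μ i j ∈ ⋀[A]^1 Ω[A⁄k] := maurerCartan_mem (k := k) X
  set l : Forms k A := ExteriorAlgebra.ι A (((c⁻¹ : Aˣ) : A) • KaehlerDifferential.D k A c) with hl
  set L : Matrix n n (Forms k A) := Matrix.diagonal fun _ => l with hL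
  have h1 : maurerCartan k ((c : A) • X) = μ + L := by
    have e1 : ((c : A) • X)⁻¹ = ((c⁻¹ : Aˣ) : A) • X⁻¹ := by
      apply Matrix.inv_eq_right_inv
      rw [smul_mul_smul_comm, Units.mul_inv, one_smul, Matrix.mul_nonsing_inv X hd]
    have e2 : ((c : A) • X).map (dFun k A) = (c : A) • X.map (dFun k A)
        + X.map (algebraMap A _) * Matrix.diagonal fun _ => dFun k A c := by
      ext1 i j
      rw [Matrix.map_apply, Matrix.smul_apply, smul_eq_mul, dFun_mul, Matrix.add_apply,
        Matrix.smul_apply, Matrix.mul_diagonal, Algebra.smul_def]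
      rfl
    have e4 : X⁻¹.map (algebraMap A (Forms k A)) * X.map (algebraMap A (Forms k A)) = 1 :=
      map_algebraMap_mul_eq_one (Matrix.nonsing_inv_mul X hd)
    rw [maurerCartan, e1, map_algebraMap_smul, e2, mul_add, smul_mul_smul_comm, Units.inv_mul,
      one_smul, smul_mul_assoc, ← mul_assoc, e4, one_mul]
    congr 1
    ext1 i j
    rw [Matrix.smul_apply, hL, Matrix.diagonal_apply, Matrix.diagonal_apply, hl, map_smul]
    split_ifs
    · rfl
    · exact smul_zero _
  have hLL : L * L = 0 := by
    rw [hL, Matrix.diagonal_mul_diagonal, hl, ExteriorAlgebra.ι_sq_zero, Matrix.diagonal_zero]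
  have hLμ : L * μ = -(μ * L) := by
    ext1 i j
    rw [hL, Matrix.diagonal_mul, Matrix.neg_apply, Matrix.mul_diagonal, hl,
      ι_mul_of_mem_exteriorPower _ (dμ i j), pow_one, neg_one_mul]
  have hsq : (μ + L) ^ 2 = μ ^ 2 := by
    rw [pow_two, add_mul, mul_add, mul_add, hLL, hLμ, add_zero, add_assoc, add_neg_cancel,
      add_zero, pow_two]
  have htr : (μ ^ (2 * r) * L).trace = 0 := by
    have : (μ ^ (2 * r) * L).trace = (μ ^ (2 * r)).trace * l := by
      simp only [Matrix.trace, Matrix.diag_apply, hL, Matrix.mul_diagonal, Finset.sum_mul]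
    rw [this, trace_pow_even_eq_zero h2 dμ (by simp) (by lia), zero_mul]
  rw [invariantTrace, invariantTrace, h1, pow_succ, pow_mul, hsq, ← pow_mul, mul_add, ← pow_succ,
    Matrix.trace_add, htr, add_zero]

/-- The invariant traces do not change under congruence by an invertible matrix of constants. -/
theorem invariantTrace_conj (X : Matrix n n A) (hX : IsUnit X) (P : Matrix n m k)
    (Q : Matrix m n k) (hPQ : P * Q = 1) (hQP : Q * P = 1) (r : ℕ) :
    invariantTrace k ((P.map (algebraMap k A)).transpose * X * P.map (algebraMap k A)) r
      = invariantTrace k X r := by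
  obtain ⟨P', hP'⟩ : ∃ P', P' = P.map (algebraMap k A) := ⟨_, rfl⟩
  obtain ⟨Q', hQ'⟩ : ∃ Q', Q' = Q.map (algebraMap k A) := ⟨_, rfl⟩
  rw [← hP']
  have hPQ' : P' * Q' = 1 := by
    rw [hP', hQ', ← Matrix.map_mul, hPQ, Matrix.map_one _ (map_zero _) (map_one _)]
  have hQP' : Q' * P' = 1 := by
    rw [hP', hQ', ← Matrix.map_mul, hQP, Matrix.map_one _ (map_zero _) (map_one _)]
  have hd := (Matrix.isUnit_iff_isUnit_det X).1 hX
  have e1 : (P'.transpose * X * P')⁻¹ = Q' * X⁻¹ * Q'.transpose := by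
    apply Matrix.inv_eq_right_inv
    calc P'.transpose * X * P' * (Q' * X⁻¹ * Q'.transpose)
        = P'.transpose * (X * (P' * Q') * X⁻¹) * Q'.transpose := by simp only [Matrix.mul_assoc]
      _ = 1 := by
        rw [hPQ', Matrix.mul_one, Matrix.mul_nonsing_inv X hd, Matrix.mul_one,
          ← Matrix.transpose_mul, hQP', Matrix.transpose_one]
  have hP0 : P'.map (dFun k A) = 0 := by
    rw [hP']; ext1 i j; exact dFun_algebraMap _
  have hPt0 : P'.transpose.map (dFun k A) = 0 := by
    rw [hP']; ext1 i j; exact dFun_algebraMap _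
  set p := P'.map (algebraMap A (Forms k A)) with hp
  set q := Q'.map (algebraMap A (Forms k A)) with hq
  have hpq : p * q = 1 := map_algebraMap_mul_eq_one hPQ'
  have hqp : q * p = 1 := map_algebraMap_mul_eq_one hQP'
  have hqp' : q.transpose * p.transpose = 1 := by
    rw [hp, hq, ← Matrix.transpose_map, ← Matrix.transpose_map]
    exact map_algebraMap_mul_eq_one (by rw [← Matrix.transpose_mul, hPQ', Matrix.transpose_one])
  have h1 : maurerCartan k (P'.transpose * X * P') = q * maurerCartan k X * p := by
    have e2 : (P'.transpose * X * P').map (dFun k A) = p.transpose * X.map (dFun k A) * p := by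
      rw [map_dFun_mul, map_dFun_mul, hP0, hPt0, hp, Matrix.transpose_map, Matrix.mul_zero,
        zero_add, Matrix.zero_mul, add_zero]
    rw [maurerCartan, maurerCartan, e1, e2, Matrix.map_mul, Matrix.map_mul, Matrix.transpose_map,
      ← hq]
    calc _ = q * X⁻¹.map (algebraMap A (Forms k A)) * (q.transpose * p.transpose)
          * X.map (dFun k A) * p := by simp only [Matrix.mul_assoc]
      _ = _ := by rw [hqp', Matrix.mul_one]; simp only [Matrix.mul_assoc]
  have h2 (r : ℕ) : (q * maurerCartan k X * p) ^ r * q = q * maurerCartan k X ^ r := by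
    induction r with
    | zero => simp
    | succ r ih =>
      calc _ = (q * maurerCartan k X * p) ^ r * q * maurerCartan k X * (p * q) := by
            rw [pow_succ]; simp only [Matrix.mul_assoc]
        _ = _ := by rw [ih, hpq, Matrix.mul_one, pow_succ, Matrix.mul_assoc]
  have dp (i j) : p i j ∈ ⋀[A]^0 Ω[A⁄k] := algebraMap_mem_exteriorPower _
  have dq (i j) : q i j ∈ ⋀[A]^0 Ω[A⁄k] := algebraMap_mem_exteriorPower _
  rw [invariantTrace, invariantTrace, h1, ← Matrix.mul_one (_ ^ r), ← hqp, ← Matrix.mul_assoc, h2,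
    trace_mul_comm_of_mem_exteriorPower (matrix_mul_mem_exteriorPower dq
      (matrix_pow_mem_exteriorPower (maurerCartan_mem X) r)) dp, Nat.mul_zero, pow_zero, one_mul,
    ← Matrix.mul_assoc, hpq, Matrix.one_mul]

/-! #### Poles -/

/-- If the symmetric matrix `X` over `A` becomes invertible over `B`, the form
`tr ((X⁻¹ dX) ^ (4 r + 1))` on `B` has a pole of order at most `r + 1` along `det X = 0`. -/
theorem exists_det_pow_smul_invariantTrace_eq {A B : Type*} [CommRing A] [CommRing B]
    [Algebra ℚ A] [Algebra ℚ B] (φ : A →ₐ[ℚ] B) (X : Matrix n n A) (hX : X.IsSymm)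
    (hu : IsUnit (X.map φ)) (r : ℕ) :
    ∃ N ∈ ⋀[A]^(4 * r + 1) Ω[A⁄ℚ],
      φ X.det ^ (r + 1) • invariantTrace ℚ (X.map φ) (4 * r + 1) = formPullback φ N := by
  obtain ⟨N, hN, e⟩ := exists_trace_adjugate_eq X hX (X.map (KaehlerDifferential.D ℚ A))
    (by rw [Matrix.IsSymm, ← Matrix.transpose_map, hX]) r
  refine ⟨N, hN, ?_⟩
  have hdet : (X.map φ).det = φ X.det := by
    rw [AlgHom.map_det, AlgHom.mapMatrix_apply]
  have hd : IsUnit (φ X.det) := hdet ▸ (Matrix.isUnit_iff_isUnit_det _).1 hu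
  have h1 := congrArg (formPullback φ) e
  have h2 := formPullback_trace_pow φ X.adjugate X (4 * r + 1)
  have hadj : (X.adjugate.map φ).map (algebraMap B (Forms ℚ B))
      = φ X.det • (X.map φ)⁻¹.map (algebraMap B (Forms ℚ B)) := by
    have : X.adjugate.map φ = φ X.det • (X.map φ)⁻¹ := by
      rw [← hdet, Matrix.inv_def, smul_smul,
        Ring.mul_inverse_cancel _ ((Matrix.isUnit_iff_isUnit_det _).1 hu), one_smul]
      exact AlgHom.map_adjugate φ X
    rw [this, map_algebraMap_smul]
  rw [hadj, smul_mul_assoc, smul_pow, Matrix.trace_smul] at h2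
  have h3 := h2.symm.trans h1
  rw [formPullback_smul, map_pow, show 4 * r + 1 = 3 * r + (r + 1) by ring, pow_add (φ X.det),
    mul_smul] at h3
  rw [show 4 * r + 1 = 3 * r + (r + 1) by ring]
  exact (hd.pow (3 * r)).smul_left_cancel.1 h3

end Calculus

/-! ### Laplacian matrices of a graph -/

section Laplacian

variable {α β : Type*} {G : Graph α β}

/-- Two orientations of the edges differ by a sign on every edge. -/
theorem EdgeOrientation.exists_sign (o o' : EdgeOrientation G) :
    ∃ ε : E(G) → ℤ, (∀ e, ε e * ε e = 1) ∧ ∀ e,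
      Finsupp.single (o'.src e) (1 : ℤ) - Finsupp.single (o'.tgt e) 1
        = ε e • (Finsupp.single (o.src e) 1 - Finsupp.single (o.tgt e) 1) := by
  have h (e : E(G)) : ∃ ε : ℤ, ε * ε = 1 ∧
      Finsupp.single (o'.src e) (1 : ℤ) - Finsupp.single (o'.tgt e) 1
        = ε • (Finsupp.single (o.src e) 1 - Finsupp.single (o.tgt e) 1) := by
    rcases (o'.isLink e).eq_and_eq_or_eq_and_eq (o.isLink e) with ⟨h1, h2⟩ | ⟨h1, h2⟩
    · exact ⟨1, by simp, by rw [Subtype.ext h1, Subtype.ext h2, one_smul]⟩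
    · exact ⟨-1, by simp, by rw [Subtype.ext h1, Subtype.ext h2, neg_one_smul, neg_sub]⟩
  choose ε h1 h2 using h
  exact ⟨ε, h1, h2⟩

/-- The inclusion of `H₁(G; ℤ)` in `ℤ^E` splits, since the image of the boundary map is free. -/
theorem EdgeOrientation.exists_retraction [Finite E(G)] (o : EdgeOrientation G) :
    ∃ r : (E(G) →₀ ℤ) →ₗ[ℤ] o.H1, ∀ x : o.H1, r x = x := by
  obtain ⟨s, hs⟩ := Module.projective_lifting_property o.boundary.rangeRestrict
    (LinearMap.id (M := LinearMap.range o.boundary)) o.boundary.surjective_rangeRestrict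
  have hs' (y) : o.boundary (s y) = y := by
    have := congrArg Subtype.val (LinearMap.congr_fun hs y)
    exact this
  refine ⟨(LinearMap.id - s.comp o.boundary.rangeRestrict).codRestrict _ fun x => ?_, fun x => ?_⟩
  · have hx : o.boundary.rangeRestrict (x : E(G) →₀ ℤ) = 0 := Subtype.ext x.2
    apply Subtype.ext
    rw [LinearMap.codRestrict_apply, LinearMap.sub_apply, LinearMap.comp_apply, hx, map_zero,
      sub_zero, LinearMap.id_apply]
  · rw [LinearMap.mem_ker, LinearMap.sub_apply, map_sub, LinearMap.comp_apply, hs', sub_eq_zero]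
    rfl

/-- The columns of the edge-cycle incidence matrix span a direct summand of `ℤ^E`. -/
theorem LaplacianChoice.exists_leftInverse_incidence [Fintype E(G)] (c : LaplacianChoice G) :
    ∃ L : Matrix (Fin c.rank) E(G) ℤ, L * c.incidence = 1 := by
  obtain ⟨r, hr⟩ := c.orientation.exists_retraction
  refine ⟨Matrix.of fun i e => c.basis.repr (r (Finsupp.single e 1)) i, ?_⟩
  ext1 i j
  have h : ∑ e : E(G), (c.basis j : E(G) →₀ ℤ) e • Finsupp.single e (1 : ℤ)
      = (c.basis j : E(G) →₀ ℤ) := by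
    simp [Finsupp.univ_sum_single]
  have h2 := congrArg (fun x => c.basis.repr (r x) i) h
  simp only [map_sum, map_smul, Finsupp.coe_finsetSum, Finset.sum_apply, Finsupp.smul_apply, hr,
    Module.Basis.repr_self, smul_eq_mul] at h2
  rw [Matrix.mul_apply, Matrix.one_apply]
  simp only [Matrix.of_apply, LaplacianChoice.incidence]
  simp only [mul_comm (c.basis.repr _ _)]
  rw [h2, Finsupp.single_apply]
  simp only [eq_comm]

/-- Two edge-cycle incidence matrices are related by signs on the edges and a change of basis over
the integers. -/
theorem LaplacianChoice.exists_incidence_eq (c c' : LaplacianChoice G) :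
    ∃ (ε : E(G) → ℤ) (P : Matrix (Fin c.rank) (Fin c'.rank) ℤ)
      (Q : Matrix (Fin c'.rank) (Fin c.rank) ℤ), (∀ e, ε e * ε e = 1) ∧ P * Q = 1 ∧ Q * P = 1 ∧
      ∀ e j, c'.incidence e j = ε e * (c.incidence * P) e j := by
  obtain ⟨ε, hε, hb⟩ := c.orientation.exists_sign c'.orientation
  let T₀ : (E(G) →₀ ℤ) →ₗ[ℤ] (E(G) →₀ ℤ) :=
    Finsupp.lsum ℤ fun e => ε e • Finsupp.lsingle e
  have hT₀ (x : E(G) →₀ ℤ) (e) : T₀ x e = ε e * x e := by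
    induction x using Finsupp.induction_linear with
    | zero => simp
    | add x y hx hy => rw [map_add, Finsupp.add_apply, hx, hy, Finsupp.add_apply, mul_add]
    | single f a =>
      simp only [T₀, Finsupp.lsum_single, LinearMap.smul_apply, Finsupp.lsingle_apply,
        Finsupp.smul_apply, smul_eq_mul]
      by_cases h : e = f
      · rw [h]
      · rw [Finsupp.single_eq_of_ne h, mul_zero, mul_zero]
  have hTT (x) : T₀ (T₀ x) = x := by
    ext e; rw [hT₀, hT₀, ← mul_assoc, hε, one_mul]
  have hbd' (x : E(G) →₀ ℤ) : c'.orientation.boundary x = c.orientation.boundary (T₀ x) := by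
    induction x using Finsupp.induction_linear with
    | zero => simp
    | add x y hx hy => rw [map_add, map_add, map_add, hx, hy]
    | single f a =>
      simp only [T₀, EdgeOrientation.boundary, Finsupp.lsum_single, LinearMap.smul_apply,
        Finsupp.lsingle_apply, Finsupp.linearCombination_single, map_smul, hb f]
      rw [smul_comm]
  let T : c'.orientation.H1 ≃ₗ[ℤ] c.orientation.H1 :=
    LinearEquiv.ofLinearMap
      (T₀.restrict fun x hx => by
        rw [LinearMap.mem_ker] at hx ⊢; rw [← hbd', hx])
      (T₀.restrict fun x hx => by
        rw [LinearMap.mem_ker] at hx ⊢; rw [hbd', hTT, hx])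
      (by ext1 x; exact Subtype.ext (hTT x)) (by ext1 x; exact Subtype.ext (hTT x))
  let b' := c'.basis.map T
  refine ⟨ε, c.basis.toMatrix b', b'.toMatrix c.basis, hε, c.basis.toMatrix_mul_toMatrix_flip b',
    b'.toMatrix_mul_toMatrix_flip c.basis, fun e j => ?_⟩
  have h1 : ∑ i, c.basis.toMatrix b' i j • c.basis i = b' j := c.basis.sum_toMatrix_smul_self b' j
  have h2 : (c.incidence * c.basis.toMatrix b') e j = (b' j : E(G) →₀ ℤ) e := by
    rw [← h1, Matrix.mul_apply]
    simp only [LaplacianChoice.incidence, Matrix.of_apply, Submodule.coe_sum, Submodule.coe_smul,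
      Finsupp.coe_finsetSum, Finset.sum_apply, Finsupp.smul_apply, smul_eq_mul]
    exact Finset.sum_congr rfl fun i _ => mul_comm _ _
  have h3 : (b' j : E(G) →₀ ℤ) e = ε e * c'.incidence e j := hT₀ _ e
  rw [h2, h3, ← mul_assoc, hε, one_mul]

variable [Fintype E(G)]

theorem LaplacianChoice.map_laplacian [DecidableEq E(G)] {A : Type*} [CommRing A]
    (c : LaplacianChoice G) (φ : MvPolynomial E(G) ℚ →+* A) :
    c.laplacian.map φ = (c.incidence.map (Int.cast : ℤ → A)).transpose *
      Matrix.diagonal (fun e => φ (MvPolynomial.X e)) * c.incidence.map (Int.cast : ℤ → A) := by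
  ext1 i j
  rw [Matrix.map_apply, LaplacianChoice.laplacian_apply, map_sum, Matrix.mul_apply]
  refine Finset.sum_congr rfl fun e _ => ?_
  rw [Matrix.mul_diagonal, map_mul, map_mul, map_intCast, map_intCast]
  rfl

theorem LaplacianChoice.isSymm_laplacian (c : LaplacianChoice G) : c.laplacian.IsSymm := by
  ext1 i j
  rw [Matrix.transpose_apply, LaplacianChoice.laplacian_apply, LaplacianChoice.laplacian_apply]
  exact Finset.sum_congr rfl fun e _ => by ring

/-- Two Laplacian matrices are congruent over the integers. -/
theorem LaplacianChoice.exists_laplacian_eq (c c' : LaplacianChoice G) :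
    ∃ (P : Matrix (Fin c.rank) (Fin c'.rank) ℤ) (Q : Matrix (Fin c'.rank) (Fin c.rank) ℤ),
      P * Q = 1 ∧ Q * P = 1 ∧
      c'.laplacian = (P.map (Int.cast : ℤ → MvPolynomial E(G) ℚ)).transpose * c.laplacian *
        P.map (Int.cast : ℤ → MvPolynomial E(G) ℚ) := by
  classical
  obtain ⟨ε, P, Q, hε, hPQ, hQP, h⟩ := c.exists_incidence_eq c'
  refine ⟨P, Q, hPQ, hQP, ?_⟩
  have hid (d : LaplacianChoice G) : d.laplacian = d.laplacian.map (RingHom.id _) := by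
    ext1 i j; rfl
  set i : ℤ → MvPolynomial E(G) ℚ := Int.cast with hi
  have hinc : c'.incidence.map i
      = Matrix.diagonal (fun e => i (ε e)) * (c.incidence.map i * P.map i) := by
    ext1 e j
    have : c.incidence.map i * P.map i = (c.incidence * P).map i :=
      (Matrix.map_mul (f := Int.castRingHom (MvPolynomial E(G) ℚ))).symm
    rw [Matrix.diagonal_mul, Matrix.map_apply, h, this, hi, Int.cast_mul, Matrix.map_apply]
  have hdiag : Matrix.diagonal (fun e => i (ε e)) *
      Matrix.diagonal (fun e => RingHom.id _ (MvPolynomial.X e : MvPolynomial E(G) ℚ)) *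
      Matrix.diagonal (fun e => i (ε e))
      = Matrix.diagonal (fun e => RingHom.id _ (MvPolynomial.X e : MvPolynomial E(G) ℚ)) := by
    rw [Matrix.diagonal_mul_diagonal, Matrix.diagonal_mul_diagonal]
    congr 1
    ext1 e
    rw [mul_right_comm, hi, ← Int.cast_mul, hε, Int.cast_one, one_mul]
  rw [hid c', hid c, c'.map_laplacian, c.map_laplacian, hinc, Matrix.transpose_mul,
    Matrix.transpose_mul, Matrix.diagonal_transpose]
  conv_rhs => rw [← hdiag]
  simp only [Matrix.mul_assoc, hi]

/-- The Gram determinant of a unimodular integral matrix, whose determinant is `±1` once its two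
index types are identified. -/
theorem det_mul_transpose_eq_one {m n : Type*} [Fintype m] [Fintype n] [DecidableEq m]
    [DecidableEq n] {P : Matrix n m ℤ} {Q : Matrix m n ℤ} (hPQ : P * Q = 1) (hQP : Q * P = 1) :
    (P * P.transpose).det = 1 := by
  let e := Matrix.indexEquivOfInv hPQ hQP
  have h1 : P * P.transpose = P.submatrix id e * (P.submatrix id e).transpose := by
    rw [Matrix.transpose_submatrix, Matrix.submatrix_mul_equiv, Matrix.submatrix_id_id]
  have h2 : P * P.transpose * (Q.transpose * Q) = 1 := by
    rw [Matrix.mul_assoc, ← Matrix.mul_assoc P.transpose, ← Matrix.transpose_mul, hQP,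
      Matrix.transpose_one, Matrix.one_mul, hPQ]
  have h3 : IsUnit (P * P.transpose).det :=
    IsUnit.of_mul_eq_one _ (by rw [← Matrix.det_mul, h2, Matrix.det_one])
  rw [h1, Matrix.det_mul, Matrix.det_transpose] at h3 ⊢
  rcases Int.isUnit_iff.1 h3 with h | h
  · exact h
  · nlinarith [mul_self_nonneg (P.submatrix id e).det]

theorem LaplacianChoice.det_laplacian_eq (c c' : LaplacianChoice G) :
    c'.laplacian.det = c.laplacian.det := by
  obtain ⟨P, Q, hPQ, hQP, h⟩ := c.exists_laplacian_eq c'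
  let f := Int.castRingHom (MvPolynomial E(G) ℚ)
  have hP : P.map f * Q.map f = 1 := by
    rw [← Matrix.map_mul, hPQ, Matrix.map_one _ (map_zero _) (map_one _)]
  have hQ : Q.map f * P.map f = 1 := by
    rw [← Matrix.map_mul, hQP, Matrix.map_one _ (map_zero _) (map_one _)]
  have hd : (P.map f * (P.map f).transpose).det = 1 := by
    rw [← Matrix.transpose_map, ← Matrix.map_mul, ← RingHom.mapMatrix_apply, ← RingHom.map_det,
      det_mul_transpose_eq_one hPQ hQP, map_one]
  rw [h]
  change ((P.map f).transpose * c.laplacian * P.map f).det = _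
  rw [← Matrix.det_comm' hP hQ, ← Matrix.mul_assoc, Matrix.det_mul, hd, one_mul]

theorem LaplacianChoice.det_laplacian (c : LaplacianChoice G) :
    c.laplacian.det = graphPoly G :=
  LaplacianChoice.det_laplacian_eq _ c

theorem LaplacianChoice.isUnit_map_laplacian (c : LaplacianChoice G) :
    IsUnit (c.laplacian.map (polyToCone G)) := by
  rw [Matrix.isUnit_iff_isUnit_det, ← AlgHom.mapMatrix_apply, ← AlgHom.map_det, c.det_laplacian]
  exact IsLocalization.Away.algebraMap_isUnit (graphPoly G)

theorem LaplacianChoice.canonicalForm_eq (c c' : LaplacianChoice G) (r : ℕ) :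
    c'.canonicalForm r = c.canonicalForm r := by
  obtain ⟨P, Q, hPQ, hQP, h⟩ := c.exists_laplacian_eq c'
  let f := Int.castRingHom ℚ
  have hP : P.map f * Q.map f = 1 := by
    rw [← Matrix.map_mul, hPQ, Matrix.map_one _ (map_zero _) (map_one _)]
  have hQ : Q.map f * P.map f = 1 := by
    rw [← Matrix.map_mul, hQP, Matrix.map_one _ (map_zero _) (map_one _)]
  have hm : (P.map (Int.cast : ℤ → MvPolynomial E(G) ℚ)).map (polyToCone G)
      = (P.map f).map (algebraMap ℚ (ConeRing G)) := by
    ext1 i j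
    simp [f]
  rw [LaplacianChoice.canonicalForm, LaplacianChoice.canonicalForm, h, Matrix.map_mul,
    Matrix.map_mul, Matrix.transpose_map, hm]
  exact invariantTrace_conj _ c.isUnit_map_laplacian _ _ hP hQ r

/-- At a positive real point the Laplacian matrix `Hᵀ D H` is positive definite, since `D` is and
`H` is injective. -/
theorem aeval_graphPoly_ne_zero {x : E(G) → ℝ} (hx : x ∈ simplexCone G) :
    MvPolynomial.aeval x (graphPoly G) ≠ (0 : ℝ) := by
  classical
  set c := Classical.arbitrary (LaplacianChoice G)
  let φ : MvPolynomial E(G) ℚ →+* ℝ := (MvPolynomial.aeval x : MvPolynomial E(G) ℚ →ₐ[ℚ] ℝ)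
  change φ (graphPoly G) ≠ 0
  rw [← c.det_laplacian, RingHom.map_det, RingHom.mapMatrix_apply, c.map_laplacian]
  intro h0
  obtain ⟨v, hv, hv0⟩ := Matrix.exists_mulVec_eq_zero_iff.2 h0
  set H : Matrix E(G) (Fin c.rank) ℝ := c.incidence.map (Int.cast : ℤ → ℝ) with hH
  set w := H.mulVec v with hw
  have h1 : ∑ e, x e * w e ^ 2 = 0 := by
    have h2 := congrArg (fun u => v ⬝ᵥ u) hv0
    simp only [dotProduct_zero] at h2
    rw [← Matrix.mulVec_mulVec, ← Matrix.mulVec_mulVec, Matrix.dotProduct_mulVec,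
      Matrix.vecMul_transpose, ← hw, dotProduct] at h2
    rw [← h2]
    refine Finset.sum_congr rfl fun e _ => ?_
    rw [Matrix.mulVec_diagonal]
    simp only [φ, RingHom.coe_coe, MvPolynomial.aeval_X]
    ring
  have hw0 : w = 0 := by
    ext1 e
    have := (Finset.sum_eq_zero_iff_of_nonneg
      fun e _ => mul_nonneg (hx e).le (sq_nonneg (w e))).1 h1 e (Finset.mem_univ e)
    simpa [(hx e).ne'] using this
  obtain ⟨L, hL⟩ := c.exists_leftInverse_incidence
  have hLH : L.map (Int.castRingHom ℝ) * H = 1 := by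
    rw [hH, ← Matrix.map_one (Int.castRingHom ℝ) (map_zero _) (map_one _), ← hL, Matrix.map_mul]
    rfl
  apply hv
  rw [← Matrix.one_mulVec v, ← hLH, ← Matrix.mulVec_mulVec, ← hw, hw0, Matrix.mulVec_zero]

end Laplacian

/-! ### Dehomogenization and the charts of projective space -/

section Charts

/-- Rescaling the variables by `u` rescales a form of degree `d` by `u ^ d`. -/
theorem _root_.MvPolynomial.IsHomogeneous.map_mul_pow_eq {σ R B : Type*} [CommSemiring R]
    [CommSemiring B] [Algebra R B] {p : MvPolynomial σ R} {d : ℕ} (hp : p.IsHomogeneous d)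
    (φ ψ : MvPolynomial σ R →ₐ[R] B) (u : B)
    (h : ∀ i, φ (MvPolynomial.X i) * u = ψ (MvPolynomial.X i)) : φ p * u ^ d = ψ p := by
  conv_lhs => rw [p.as_sum]
  conv_rhs => rw [p.as_sum]
  rw [map_sum, map_sum, Finset.sum_mul]
  refine Finset.sum_congr rfl fun m hm => ?_
  have hd : m.degree = d := by
    rw [← hp (MvPolynomial.mem_support_iff.1 hm), Finsupp.degree_eq_weight_one]
    rfl
  have hu : u ^ d = ∏ i ∈ m.support, u ^ m i := by
    rw [Finset.prod_pow_eq_pow_sum, ← hd]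
    rfl
  rw [MvPolynomial.monomial_eq, map_mul, map_mul, Finsupp.prod, map_prod, map_prod, mul_assoc,
    ← MvPolynomial.algebraMap_eq, AlgHom.commutes, AlgHom.commutes, hu,
    ← Finset.prod_mul_distrib]
  congr 1
  refine Finset.prod_congr rfl fun i _ => ?_
  rw [map_pow, map_pow, ← mul_pow, h]

variable {α β : Type*} {G : Graph α β}

/-- Dehomogenization: the map `x_f ↦ x_f / x_e`. -/
noncomputable def dehom (e : E(G)) : MvPolynomial E(G) ℚ →ₐ[ℚ] StdChartRing e :=
  MvPolynomial.aeval (coord e)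

theorem dehom_X (e f : E(G)) : dehom e (MvPolynomial.X f) = coord e f :=
  MvPolynomial.aeval_X _ _

theorem val_awayMk_mul {σ : Type*} {f : MvPolynomial σ ℚ} {d : ℕ}
    (hf : f ∈ homogeneousSubmodule σ ℚ d) (n : ℕ) (a : MvPolynomial σ ℚ)
    (ha : a ∈ homogeneousSubmodule σ ℚ (n • d)) :
    (HomogeneousLocalization.Away.mk _ hf n a ha).val *
      algebraMap (MvPolynomial σ ℚ) (Localization.Away f) (f ^ n)
      = algebraMap (MvPolynomial σ ℚ) (Localization.Away f) a := by
  rw [HomogeneousLocalization.Away.val_mk, Localization.mk_eq_mk']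
  exact IsLocalization.mk'_spec _ _ _

/-- An identity `z b = a` in a homogeneous localization persists under further localization. -/
theorem val_awayMap_mul {σ : Type*} {f g x : MvPolynomial σ ℚ} {d : ℕ}
    (hg : g ∈ homogeneousSubmodule σ ℚ d) (hx : x = f * g)
    (z : HomogeneousLocalization.Away (homogeneousSubmodule σ ℚ) f) (a b : MvPolynomial σ ℚ)
    (h : z.val * algebraMap (MvPolynomial σ ℚ) (Localization.Away f) b
      = algebraMap (MvPolynomial σ ℚ) (Localization.Away f) a) :
    (HomogeneousLocalization.awayMap (homogeneousSubmodule σ ℚ) hg hx z).val *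
      algebraMap (MvPolynomial σ ℚ) (Localization.Away x) b
      = algebraMap (MvPolynomial σ ℚ) (Localization.Away x) a := by
  have hu : IsUnit (algebraMap (MvPolynomial σ ℚ) (Localization.Away x) f) :=
    isUnit_of_dvd_unit (map_dvd _ ⟨g, hx⟩) (IsLocalization.Away.algebraMap_isUnit x)
  have h1 := congrArg (Localization.awayLift (algebraMap (MvPolynomial σ ℚ)
    (Localization.Away x)) f hu) h
  have h2 (p : MvPolynomial σ ℚ) : Localization.awayLift (algebraMap (MvPolynomial σ ℚ)
      (Localization.Away x)) f hu (algebraMap (MvPolynomial σ ℚ) (Localization.Away f) p)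
      = algebraMap (MvPolynomial σ ℚ) (Localization.Away x) p := IsLocalization.lift_eq _ _
  rw [map_mul, h2, h2] at h1
  rw [HomogeneousLocalization.val_awayMap, h1]

theorem val_coord_mul (e f : E(G)) : (coord e f).val *
      algebraMap (MvPolynomial E(G) ℚ) (Localization.Away (MvPolynomial.X e)) (MvPolynomial.X e) =
    algebraMap (MvPolynomial E(G) ℚ) (Localization.Away (MvPolynomial.X e))
      (MvPolynomial.X f) := by
  have := val_awayMk_mul (X_mem e) 1 (MvPolynomial.X f) (X_mem f)
  rwa [pow_one] at this

variable [Fintype E(G)]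

/-- Dehomogenization, with values in the functions on the complement of the hypersurface. -/
noncomputable abbrev chartDehom (e : E(G)) : MvPolynomial E(G) ℚ →ₐ[ℚ] ChartRing e :=
  (stdChartToChart e).comp (dehom e)

/-- Restriction of polynomial functions to the part of the cone over the chart `e`. -/
noncomputable abbrev polyToConeChart (e : E(G)) : MvPolynomial E(G) ℚ →ₐ[ℚ] ConeChartRing e :=
  (algebraMap (MvPolynomial E(G) ℚ) (ConeChartRing e)).toRatAlgHom

theorem graphPoly_mul_X_mem (e : E(G)) :
    graphPoly G * MvPolynomial.X e ∈ homogeneousSubmodule E(G) ℚ (loopNumber G + 1) :=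
  SetLike.mul_mem_graded (graphPoly_mem G) (X_mem e)

theorem isUnit_polyToConeChart (e : E(G)) :
    IsUnit (polyToConeChart e (graphPoly G * MvPolynomial.X e)) :=
  IsLocalization.Away.algebraMap_isUnit (graphPoly G * MvPolynomial.X e)

theorem isUnit_polyToConeChart_X (e : E(G)) :
    IsUnit (polyToConeChart e (MvPolynomial.X e)) :=
  isUnit_of_mul_isUnit_right (by rw [← map_mul]; exact isUnit_polyToConeChart e)

theorem chartToConeChart_injective (e : E(G)) : Function.Injective (chartToConeChart e) :=
  HomogeneousLocalization.val_injective _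

theorem coneToConeChart_comp (e : E(G)) :
    (coneToConeChart e).comp (polyToCone G) = polyToConeChart e := by
  ext1 f
  exact IsLocalization.Away.awayToAwayRight_eq (S := ConeRing G) (P := ConeChartRing e)
    (graphPoly G) (MvPolynomial.X e) (MvPolynomial.X f)

theorem val_stdChartToChart_coord_mul (e f : E(G)) :
    (stdChartToChart e (coord e f)).val *
      algebraMap (MvPolynomial E(G) ℚ) (ConeChartRing e) (MvPolynomial.X e) =
    algebraMap (MvPolynomial E(G) ℚ) (ConeChartRing e) (MvPolynomial.X f) :=
  val_awayMap_mul (graphPoly_mem G) (mul_comm (graphPoly G) (MvPolynomial.X e)) _ _ _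
    (val_coord_mul e f)

theorem chartToConeChart_awayMk_mul (e : E(G)) (n : ℕ) (a : MvPolynomial E(G) ℚ)
    (ha : a ∈ homogeneousSubmodule E(G) ℚ (n • (loopNumber G + 1))) :
    chartToConeChart e (HomogeneousLocalization.Away.mk _ (graphPoly_mul_X_mem e) n a ha) *
      polyToConeChart e (graphPoly G * MvPolynomial.X e) ^ n = polyToConeChart e a := by
  rw [← map_pow]
  exact val_awayMk_mul (graphPoly_mul_X_mem e) n a ha

theorem chartToConeChart_coord (e f : E(G)) :
    chartToConeChart e (stdChartToChart e (coord e f)) *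
      polyToConeChart e (MvPolynomial.X e) = polyToConeChart e (MvPolynomial.X f) :=
  val_stdChartToChart_coord_mul e f

/-- On the cone, dehomogenization divides a form of degree `d` by `x_e ^ d`. -/
theorem chartToConeChart_chartDehom (e : E(G)) {p : MvPolynomial E(G) ℚ} {d : ℕ}
    (hp : p ∈ homogeneousSubmodule E(G) ℚ d) :
    chartToConeChart e (chartDehom e p) * polyToConeChart e (MvPolynomial.X e) ^ d
      = polyToConeChart e p :=
  MvPolynomial.IsHomogeneous.map_mul_pow_eq hp ((chartToConeChart e).comp (chartDehom e)) _ _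
    fun f => by
      change chartToConeChart e (stdChartToChart e (dehom e _)) * _ = _
      rw [dehom_X, chartToConeChart_coord]

theorem chartDehom_X_self (e : E(G)) : chartDehom e (MvPolynomial.X e) = 1 := by
  apply chartToConeChart_injective e
  apply (isUnit_polyToConeChart_X e).mul_right_cancel
  rw [map_one, one_mul]
  simpa using chartToConeChart_chartDehom e (X_mem e)

/-- Every function on a chart is a quotient of dehomogenized polynomials. -/
theorem awayMk_mul_chartDehom_pow (e : E(G)) (n : ℕ) (a : MvPolynomial E(G) ℚ)
    (ha : a ∈ homogeneousSubmodule E(G) ℚ (n • (loopNumber G + 1))) :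
    HomogeneousLocalization.Away.mk _ (graphPoly_mul_X_mem e) n a ha *
      chartDehom e (graphPoly G * MvPolynomial.X e) ^ n = chartDehom e a := by
  apply chartToConeChart_injective e
  apply ((isUnit_polyToConeChart_X e).pow (n * (loopNumber G + 1))).mul_right_cancel
  have h1 := chartToConeChart_chartDehom e ha
  have h2 := chartToConeChart_chartDehom e (graphPoly_mul_X_mem e)
  have h3 := chartToConeChart_awayMk_mul e n a ha
  rw [smul_eq_mul] at h1
  rw [h1, map_mul, map_pow, mul_comm n, pow_mul, mul_assoc, ← mul_pow, h2, h3]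

theorem isUnit_chartDehom (e : E(G)) :
    IsUnit (chartDehom e (graphPoly G * MvPolynomial.X e)) := by
  have hm : MvPolynomial.X e ^ (loopNumber G + 1) ∈
      homogeneousSubmodule E(G) ℚ (1 • (loopNumber G + 1)) := by
    simpa using SetLike.pow_mem_graded (loopNumber G + 1) (X_mem e)
  have h := awayMk_mul_chartDehom_pow e 1 _ hm
  rw [map_pow, chartDehom_X_self, one_pow, pow_one] at h
  exact IsUnit.of_mul_eq_one_right _ h

theorem isUnit_chartDehom_graphPoly (e : E(G)) : IsUnit (chartDehom e (graphPoly G)) :=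
  isUnit_of_mul_isUnit_left (by rw [← map_mul]; exact isUnit_chartDehom e)

theorem dehom_graphPoly (e : E(G)) : dehom e (graphPoly G) = localEquation e := by
  apply HomogeneousLocalization.val_injective
  have hu : IsUnit (algebraMap (MvPolynomial E(G) ℚ)
      (Localization.Away (MvPolynomial.X e : MvPolynomial E(G) ℚ)) (MvPolynomial.X e)) :=
    IsLocalization.Away.algebraMap_isUnit (MvPolynomial.X e)
  apply (hu.pow (loopNumber G)).mul_right_cancel
  have h1 : (localEquation e).val * _ = _ := val_awayMk_mul (X_mem e) (loopNumber G) (graphPoly G)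
    (by simpa using graphPoly_mem G)
  rw [map_pow] at h1
  rw [h1]
  let v : StdChartRing e →ₐ[ℚ] Localization.Away (MvPolynomial.X e : MvPolynomial E(G) ℚ) :=
    (algebraMap (StdChartRing e) (Localization.Away (MvPolynomial.X e))).toRatAlgHom
  refine MvPolynomial.IsHomogeneous.map_mul_pow_eq (graphPoly_mem G) (v.comp (dehom e))
    (algebraMap _ (Localization.Away (MvPolynomial.X e))).toRatAlgHom _ fun f => ?_
  change (dehom e (MvPolynomial.X f)).val * _ = algebraMap _ _ _
  rw [dehom_X]
  exact val_coord_mul e f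

/-- The retraction of the projection from the cone given by the section `x_e = 1`. -/
noncomputable def coneChartRetraction (e : E(G)) : ConeChartRing e →ₐ[ℚ] ChartRing e :=
  (IsLocalization.Away.lift (S := ConeChartRing e) (graphPoly G * MvPolynomial.X e)
    (g := (chartDehom e : MvPolynomial E(G) ℚ →+* ChartRing e))
    (isUnit_chartDehom e)).toRatAlgHom

theorem coneChartRetraction_polyToConeChart (e : E(G)) (p : MvPolynomial E(G) ℚ) :
    coneChartRetraction e (polyToConeChart e p) = chartDehom e p :=
  IsLocalization.Away.lift_eq (S := ConeChartRing e) (graphPoly G * MvPolynomial.X e)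
    (isUnit_chartDehom e) p

theorem coneChartRetraction_comp (e : E(G)) :
    (coneChartRetraction e).comp (chartToConeChart e) = AlgHom.id ℚ (ChartRing e) := by
  ext1 z
  obtain ⟨n, a, ha, rfl⟩ :=
    HomogeneousLocalization.Away.mk_surjective _ (graphPoly_mul_X_mem e) z
  apply ((isUnit_chartDehom e).pow n).mul_right_cancel
  rw [AlgHom.id_apply, awayMk_mul_chartDehom_pow]
  have h := congrArg (coneChartRetraction e) (chartToConeChart_awayMk_mul e n a ha)
  rwa [map_mul, map_pow, coneChartRetraction_polyToConeChart,
    coneChartRetraction_polyToConeChart] at h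

/-- The pullback of forms from a chart to the cone over it has a left inverse, the pullback to the
section `x_e = 1`. -/
theorem formPullback_chartToConeChart_injective (e : E(G)) :
    Function.Injective (formPullback (chartToConeChart e)) :=
  Function.LeftInverse.injective (g := formPullback (coneChartRetraction e)) fun w => by
    rw [formPullback_comp, coneChartRetraction_comp, formPullback_id]

/-! ### Changes of charts -/

theorem isUnit_overlap (e f : E(G)) :
    IsUnit (algebraMap (MvPolynomial E(G) ℚ)
      (Localization.Away (graphPoly G * MvPolynomial.X e * MvPolynomial.X f))
      (MvPolynomial.X f)) := by
  have h : IsUnit (algebraMap (MvPolynomial E(G) ℚ)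
      (Localization.Away (graphPoly G * MvPolynomial.X e * MvPolynomial.X f))
      (graphPoly G * MvPolynomial.X e * MvPolynomial.X f)) :=
    IsLocalization.Away.algebraMap_isUnit (graphPoly G * MvPolynomial.X e * MvPolynomial.X f)
  exact isUnit_of_dvd_unit (map_dvd _ (dvd_mul_left _ _)) h

theorem val_chartToOverlapLeft (e f i : E(G)) :
    (chartToOverlapLeft e f (stdChartToChart e (coord e i))).val *
      algebraMap (MvPolynomial E(G) ℚ)
        (Localization.Away (graphPoly G * MvPolynomial.X e * MvPolynomial.X f))
        (MvPolynomial.X e) =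
    algebraMap (MvPolynomial E(G) ℚ)
      (Localization.Away (graphPoly G * MvPolynomial.X e * MvPolynomial.X f))
      (MvPolynomial.X i) :=
  val_awayMap_mul (X_mem f) rfl _ _ _ (val_stdChartToChart_coord_mul e i)

theorem val_chartToOverlapRight (e f i : E(G)) :
    (chartToOverlapRight e f (stdChartToChart f (coord f i))).val *
      algebraMap (MvPolynomial E(G) ℚ)
        (Localization.Away (graphPoly G * MvPolynomial.X e * MvPolynomial.X f))
        (MvPolynomial.X f) =
    algebraMap (MvPolynomial E(G) ℚ)
      (Localization.Away (graphPoly G * MvPolynomial.X e * MvPolynomial.X f))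
      (MvPolynomial.X i) :=
  val_awayMap_mul (X_mem e) (mul_right_comm (graphPoly G) (MvPolynomial.X e) (MvPolynomial.X f))
    _ _ _ (val_stdChartToChart_coord_mul f i)

/-- The transition function between two charts: `x_i / x_f = (x_i / x_e) (x_e / x_f)`. -/
theorem chartToOverlapLeft_mul (e f i : E(G)) :
    chartToOverlapLeft e f (stdChartToChart e (coord e i)) *
      chartToOverlapRight e f (stdChartToChart f (coord f e)) =
    chartToOverlapRight e f (stdChartToChart f (coord f i)) := by
  apply HomogeneousLocalization.val_injective
  apply (isUnit_overlap e f).mul_right_cancel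
  rw [HomogeneousLocalization.val_mul]
  refine (mul_assoc _ _ _).trans ((congrArg _ (val_chartToOverlapRight e f e)).trans ?_)
  exact (val_chartToOverlapLeft e f i).trans (val_chartToOverlapRight e f i).symm

theorem isUnit_chartToOverlapRight (e f : E(G)) :
    IsUnit (chartToOverlapRight e f (stdChartToChart f (coord f e))) := by
  have h := chartToOverlapLeft_mul e f f
  rw [← dehom_X f f] at h
  have h1 : stdChartToChart f (dehom f (MvPolynomial.X f)) = 1 := chartDehom_X_self f
  rw [h1, map_one] at h
  exact IsUnit.of_mul_eq_one_right _ h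

end Charts

/-! ### The form on projective space -/

section Projective

theorem isUnit_two_of_rat_algebra {A : Type*} [CommRing A] [Algebra ℚ A] : IsUnit (2 : A) := by
  rw [← map_ofNat (algebraMap ℚ A) 2]
  exact (IsUnit.mk0 (2 : ℚ) two_ne_zero).map _

variable {α β : Type*} {G : Graph α β} [Fintype E(G)]

/-- If one specialization of the edge variables is a multiple of another, so are the
corresponding Laplacian matrices. -/
theorem LaplacianChoice.map_laplacian_eq_smul {B : Type*} [CommRing B] [Algebra ℚ B]
    (c : LaplacianChoice G) (φ ψ : MvPolynomial E(G) ℚ →ₐ[ℚ] B) (u : B)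
    (h : ∀ f, φ (MvPolynomial.X f) * u = ψ (MvPolynomial.X f)) :
    c.laplacian.map ψ = u • c.laplacian.map φ := by
  ext1 i j
  rw [Matrix.smul_apply, Matrix.map_apply, Matrix.map_apply, LaplacianChoice.laplacian_apply,
    map_sum, map_sum, Finset.smul_sum]
  refine Finset.sum_congr rfl fun f _ => ?_
  simp only [map_mul, map_intCast, ← h f, smul_eq_mul]
  ring

theorem LaplacianChoice.isUnit_map_laplacian_of_isUnit {B : Type*} [CommRing B] [Algebra ℚ B]
    (c : LaplacianChoice G) (φ : MvPolynomial E(G) ℚ →ₐ[ℚ] B) (h : IsUnit (φ (graphPoly G))) :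
    IsUnit (c.laplacian.map φ) := by
  rwa [Matrix.isUnit_iff_isUnit_det, ← AlgHom.mapMatrix_apply, ← AlgHom.map_det, c.det_laplacian]

/-- Proportional specializations of the edge variables give the same invariant trace. -/
theorem LaplacianChoice.invariantTrace_map_eq {B : Type*} [CommRing B] [Algebra ℚ B]
    (c : LaplacianChoice G) (φ ψ : MvPolynomial E(G) ℚ →ₐ[ℚ] B) {u : B} (hu : IsUnit u)
    (h : ∀ f, φ (MvPolynomial.X f) * u = ψ (MvPolynomial.X f))
    (hφ : IsUnit (φ (graphPoly G))) {r : ℕ} (hr : r ≠ 0) :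
    invariantTrace ℚ (c.laplacian.map ψ) (2 * r + 1)
      = invariantTrace ℚ (c.laplacian.map φ) (2 * r + 1) := by
  rw [c.map_laplacian_eq_smul φ ψ u h]
  exact invariantTrace_smul isUnit_two_of_rat_algebra _ (c.isUnit_map_laplacian_of_isUnit φ hφ)
    hu hr

theorem formPullback_invariantTrace_map {B C : Type*} [CommRing B] [CommRing C] [Algebra ℚ B]
    [Algebra ℚ C] (c : LaplacianChoice G) (φ : MvPolynomial E(G) ℚ →ₐ[ℚ] B) (θ : B →ₐ[ℚ] C)
    (h : IsUnit (φ (graphPoly G))) (r : ℕ) :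
    formPullback θ (invariantTrace ℚ (c.laplacian.map φ) r)
      = invariantTrace ℚ (c.laplacian.map (θ.comp φ)) r := by
  rw [formPullback_invariantTrace θ _ (c.isUnit_map_laplacian_of_isUnit φ h), Matrix.map_map]
  rfl

/-- The canonical form on projective space; on the chart `x_e ≠ 0` it is the invariant trace of
the Laplacian matrix with its variables divided by `x_e`. -/
noncomputable def LaplacianChoice.projectiveForm (c : LaplacianChoice G) {r : ℕ} (hr : r ≠ 0) :
    ProjectiveForm G (2 * r + 1) where
  form e := invariantTrace ℚ (c.laplacian.map (chartDehom e)) (2 * r + 1)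
  mem e := invariantTrace_mem _ _
  compat e f := by
    rw [formPullback_invariantTrace_map c _ _ (isUnit_chartDehom_graphPoly e),
      formPullback_invariantTrace_map c _ _ (isUnit_chartDehom_graphPoly f)]
    refine (c.invariantTrace_map_eq _ _ (isUnit_chartToOverlapRight e f) (fun i => ?_)
      ((isUnit_chartDehom_graphPoly e).map (chartToOverlapLeft e f)) hr).symm
    change chartToOverlapLeft e f (stdChartToChart e (dehom e _)) * _
      = chartToOverlapRight e f (stdChartToChart f (dehom f _))
    rw [dehom_X, dehom_X, chartToOverlapLeft_mul]

theorem LaplacianChoice.projectiveForm_pullsBackTo (c : LaplacianChoice G) {r : ℕ} (hr : r ≠ 0) :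
    (c.projectiveForm hr).PullsBackTo (c.canonicalForm (2 * r + 1)) := by
  intro e
  rw [LaplacianChoice.canonicalForm, formPullback_invariantTrace_map c (polyToCone G)
    (coneToConeChart e) (IsLocalization.Away.algebraMap_isUnit (graphPoly G)),
    coneToConeChart_comp]
  refine (formPullback_invariantTrace_map c _ _ (isUnit_chartDehom_graphPoly e) _).trans ?_
  refine (c.invariantTrace_map_eq _ _ (isUnit_polyToConeChart_X e) (fun f => ?_)
    ((isUnit_chartDehom_graphPoly e).map (chartToConeChart e)) hr).symm
  simpa using chartToConeChart_chartDehom e (X_mem f)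

/-- A projective form is determined by its pullback to the cone. -/
theorem ProjectiveForm.PullsBackTo.unique {n : ℕ} {η η' : ProjectiveForm G n}
    {ω : Forms ℚ (ConeRing G)} (h : η.PullsBackTo ω) (h' : η'.PullsBackTo ω) : η = η' := by
  ext1
  funext e
  exact formPullback_chartToConeChart_injective e ((h e).trans (h' e).symm)

theorem LaplacianChoice.projectiveForm_isClosed (c : LaplacianChoice G) {r : ℕ} (hr : r ≠ 0) :
    (c.projectiveForm hr).IsClosed := fun e =>
  extD_invariantTrace isUnit_two_of_rat_algebra _
    (c.isUnit_map_laplacian_of_isUnit _ (isUnit_chartDehom_graphPoly e)) r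

/-- On a chart, the pole bound for the dehomogenized Laplacian matrix, whose determinant is the
local equation of the hypersurface. -/
theorem LaplacianChoice.exists_chart_pole (c : LaplacianChoice G) (r : ℕ) (e : E(G)) :
    ∃ N ∈ ⋀[StdChartRing e]^(4 * r + 1) Ω[StdChartRing e⁄ℚ],
      stdChartToChart e (localEquation e) ^ (r + 1) •
        invariantTrace ℚ (c.laplacian.map (chartDehom e)) (4 * r + 1)
          = formPullback (stdChartToChart e) N := by
  have hm : (c.laplacian.map (dehom e)).map (stdChartToChart e)
      = c.laplacian.map (chartDehom e) := by
    rw [Matrix.map_map]; rfl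
  obtain ⟨N, hN, h⟩ := exists_det_pow_smul_invariantTrace_eq (stdChartToChart e)
    (c.laplacian.map (dehom e))
    (by rw [Matrix.IsSymm, ← Matrix.transpose_map, c.isSymm_laplacian])
    (by
      rw [hm]
      exact c.isUnit_map_laplacian_of_isUnit _ (isUnit_chartDehom_graphPoly e)) r
  refine ⟨N, hN, ?_⟩
  rwa [hm, ← AlgHom.mapMatrix_apply, ← AlgHom.map_det, c.det_laplacian, dehom_graphPoly] at h

theorem LaplacianChoice.exists_cone_pole (c : LaplacianChoice G) (r : ℕ) :
    ∃ N ∈ ⋀[MvPolynomial E(G) ℚ]^(4 * r + 1) Ω[MvPolynomial E(G) ℚ⁄ℚ],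
      polyToCone G (graphPoly G) ^ (r + 1) • c.canonicalForm (4 * r + 1)
        = formPullback (polyToCone G) N := by
  obtain ⟨N, hN, h⟩ := exists_det_pow_smul_invariantTrace_eq (polyToCone G) c.laplacian
    c.isSymm_laplacian c.isUnit_map_laplacian r
  rw [c.det_laplacian] at h
  exact ⟨N, hN, h⟩

/-! ### Smoothness on the open simplex -/

/-- On a chart the differentials of the affine coordinates span the one-forms. -/
theorem span_D_coord_eq_top (e : E(G)) :
    Submodule.span (ChartRing e) (Set.range fun f =>
      KaehlerDifferential.D ℚ (ChartRing e) (stdChartToChart e (coord e f))) = ⊤ := by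
  rw [eq_top_iff, ← KaehlerDifferential.span_range_derivation, Submodule.span_le]
  rintro _ ⟨z, rfl⟩
  have hpoly (p : MvPolynomial E(G) ℚ) : KaehlerDifferential.D ℚ (ChartRing e) (chartDehom e p) ∈
      Submodule.span (ChartRing e) (Set.range fun f =>
        KaehlerDifferential.D ℚ (ChartRing e) (stdChartToChart e (coord e f))) := by
    induction p using MvPolynomial.induction_on with
    | C a =>
      rw [← MvPolynomial.algebraMap_eq, AlgHom.commutes, Derivation.map_algebraMap]
      exact Submodule.zero_mem _
    | add p q hp hq =>
      rw [map_add, map_add]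
      exact Submodule.add_mem _ hp hq
    | mul_X p f hp =>
      rw [map_mul, Derivation.leibniz]
      refine Submodule.add_mem _ (Submodule.smul_mem _ _ (Submodule.subset_span ⟨f, ?_⟩))
        (Submodule.smul_mem _ _ hp)
      rw [AlgHom.comp_apply, dehom_X]
  obtain ⟨n, a, ha, rfl⟩ :=
    HomogeneousLocalization.Away.mk_surjective _ (graphPoly_mul_X_mem e) z
  have h := hpoly a
  rw [← awayMk_mul_chartDehom_pow e n a ha, Derivation.leibniz] at h
  obtain ⟨u, hu⟩ := (isUnit_chartDehom e).pow n
  have h2 := (Submodule.add_mem_iff_right _ (Submodule.smul_mem _ _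
    (by rw [← map_pow]; exact hpoly _))).1 h
  rw [← hu] at h2
  have h3 := Submodule.smul_mem _ (↑u⁻¹ : ChartRing e) h2
  rwa [smul_smul, Units.inv_mul, one_smul] at h3

/-- A family which spans a module gives a spanning family of its exterior power. -/
theorem exists_eq_sum_smul_ιMulti {R M ι : Type*} [CommRing R] [AddCommGroup M] [Module R M]
    [Fintype ι] (v : ι → M) (hv : Submodule.span R (Set.range v) = ⊤) {n : ℕ}
    {w : ExteriorAlgebra R M} (hw : w ∈ ⋀[R]^n M) :
    ∃ c : (Fin n → ι) → R,
      w = ∑ I, c I • ExteriorAlgebra.ιMulti R n (fun j => v (I j)) := by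
  classical
  have hr : LinearMap.range (ExteriorAlgebra.ι R (M := M))
      = Submodule.span R (Set.range fun i => ExteriorAlgebra.ι R (v i)) := by
    rw [LinearMap.range_eq_map, ← hv, Submodule.map_span, ← Set.range_comp]
    rfl
  have hw' : w ∈ Submodule.span R (Set.range fun I : Fin n → ι =>
      ExteriorAlgebra.ιMulti R n (fun j => v (I j))) := by
    change w ∈ LinearMap.range (ExteriorAlgebra.ι R (M := M)) ^ n at hw
    rw [hr, Submodule.span_pow] at hw
    refine Submodule.span_mono ?_ hw
    intro x hx
    obtain ⟨g, rfl⟩ := Set.mem_pow.1 hx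
    choose I hI using fun j => (g j).2
    refine ⟨I, ?_⟩
    simp only [ExteriorAlgebra.ιMulti_apply]
    congr 2
    funext j
    exact hI j
  obtain ⟨c, hc⟩ := (Submodule.mem_span_range_iff_exists_fun R).1 hw'
  exact ⟨c, hc.symm⟩

theorem contDiff_aeval (p : MvPolynomial E(G) ℚ) :
    ContDiff ℝ (⊤ : ℕ∞) fun x : E(G) → ℝ => MvPolynomial.aeval x p := by
  induction p using MvPolynomial.induction_on with
  | C a =>
    simp only [MvPolynomial.aeval_C]
    exact contDiff_const
  | add p q hp hq =>
    simp only [map_add]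
    exact hp.add hq
  | mul_X p f hp =>
    simp only [map_mul, MvPolynomial.aeval_X]
    exact hp.mul (contDiff_apply ℝ ℝ f)

/-- Every function on a chart is a smooth function at the positive real points. -/
theorem contDiffOn_realValue {e : E(G)} (z : ChartRing e) :
    ContDiffOn ℝ (⊤ : ℕ∞) (realValue z) (simplexCone G) := by
  obtain ⟨n, a, ha, rfl⟩ :=
    HomogeneousLocalization.Away.mk_surjective _ (graphPoly_mul_X_mem e) z
  have hne (x : E(G) → ℝ) (hx : x ∈ simplexCone G) :
      MvPolynomial.aeval x (graphPoly G * MvPolynomial.X e) ≠ (0 : ℝ) := by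
    rw [map_mul, MvPolynomial.aeval_X]
    exact mul_ne_zero (aeval_graphPoly_ne_zero hx) (hx e).ne'
  -- positive points lie in the chart, so `realValue` does not take its default value there
  have hval : ∀ x ∈ simplexCone G, realValue (HomogeneousLocalization.Away.mk _
      (graphPoly_mul_X_mem e) n a ha) x = MvPolynomial.aeval x a /
        MvPolynomial.aeval x (graphPoly G * MvPolynomial.X e) ^ n := by
    intro x hx
    have hu : IsUnit ((MvPolynomial.aeval x : MvPolynomial E(G) ℚ →ₐ[ℚ] ℝ).toRingHom
      (graphPoly G * MvPolynomial.X e)) := IsUnit.mk0 _ (hne x hx)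
    rw [realValue, dif_pos hu, eq_div_iff (pow_ne_zero _ (hne x hx))]
    have h := congrArg (IsLocalization.Away.lift (S := ConeChartRing e)
      (graphPoly G * MvPolynomial.X e) hu) (chartToConeChart_awayMk_mul e n a ha)
    have hl (p : MvPolynomial E(G) ℚ) : IsLocalization.Away.lift (S := ConeChartRing e)
        (graphPoly G * MvPolynomial.X e) hu (polyToConeChart e p) = MvPolynomial.aeval x p :=
      IsLocalization.Away.lift_eq (S := ConeChartRing e) (graphPoly G * MvPolynomial.X e) hu p
    rwa [map_mul, map_pow, hl, hl] at h
  refine ContDiffOn.congr ?_ hval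
  exact (contDiff_aeval a).contDiffOn.div ((contDiff_aeval _).pow n).contDiffOn
    fun x hx => pow_ne_zero _ (hne x hx)

theorem ProjectiveForm.smoothOnSimplex {n : ℕ} (η : ProjectiveForm G n) : η.SmoothOnSimplex := by
  refine ⟨fun x hx => aeval_graphPoly_ne_zero hx, fun e => ?_⟩
  obtain ⟨c, hc⟩ := exists_eq_sum_smul_ιMulti _ (span_D_coord_eq_top e) (η.mem e)
  exact ⟨c, hc, fun I => contDiffOn_realValue (c I)⟩

end Projective

end GraphForms

open GraphForms
theorem mainTheorem7 {α β : Type*} (G : Graph α β) [Finite V(G)] [Fintype E(G)]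
    (hG : GraphConnected G) (k : ℕ) (hk : 1 ≤ k) :
    (∀ c : LaplacianChoice G, c.laplacian.det = graphPoly G ∧
      IsUnit (c.laplacian.map (polyToCone G))) ∧
    ∃ ω : Forms ℚ (ConeRing G),
      (∀ c : LaplacianChoice G, c.canonicalForm (4 * k + 1) = ω) ∧
      ω ∈ ⋀[ConeRing G]^(4 * k + 1) Ω[ConeRing G⁄ℚ] ∧
      extD ℚ (ConeRing G) ω = 0 ∧
      (∃ N ∈ ⋀[MvPolynomial E(G) ℚ]^(4 * k + 1) Ω[MvPolynomial E(G) ℚ⁄ℚ],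
        polyToCone G (graphPoly G) ^ (k + 1) • ω = formPullback (polyToCone G) N) ∧
      (∃! η : ProjectiveForm G (4 * k + 1), η.PullsBackTo ω) ∧
      ∀ η : ProjectiveForm G (4 * k + 1), η.PullsBackTo ω →
        η.IsClosed ∧ η.PoleOrderLE (k + 1) ∧ η.SmoothOnSimplex := by
  let c := Classical.arbitrary (LaplacianChoice G)
  obtain ⟨r, hr, hk'⟩ : ∃ r, r ≠ 0 ∧ 4 * k + 1 = 2 * r + 1 := ⟨2 * k, by omega, by omega⟩
  refine ⟨fun c => ⟨c.det_laplacian, c.isUnit_map_laplacian⟩, c.canonicalForm (4 * k + 1),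
    fun c' => c.canonicalForm_eq c' _, invariantTrace_mem _ _, ?_, c.exists_cone_pole k, ?_⟩
  · rw [hk']
    exact extD_invariantTrace isUnit_two_of_rat_algebra _ c.isUnit_map_laplacian r
  · have hpole := c.exists_chart_pole k
    rw [hk'] at hpole ⊢
    refine ⟨⟨c.projectiveForm hr, c.projectiveForm_pullsBackTo hr,
      fun η hη => hη.unique (c.projectiveForm_pullsBackTo hr)⟩, fun η hη => ?_⟩
    obtain rfl := hη.unique (c.projectiveForm_pullsBackTo hr)
    exact ⟨c.projectiveForm_isClosed hr, hpole, ProjectiveForm.smoothOnSimplex _⟩
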